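/- **Conventions.** All rings are commutative with $1$ (the zero ring is allowed). A difference field is a field $k$ with a ring endomorphism $\sigma\colon k\to k$. A difference $k$-algebra is a $k$-algebra $A$ with a ring endomorphism $\sigma_A$ satisfying $\sigma_A(c\cdot 1)=\sigma(c)\cdot 1$ for $c\in k$; morphisms are $k$-algebra maps commuting with the endomorphisms. $A$ is *difference locally étale* if every $a\in A$ is a root of a separable polynomial over $k$. $A$ is *finitely $\sigma$-generated* if there is a finite $B\subseteq A$ such that $B\cup\sigma_A(B)\cup\sigma_A^2(B)\cup\dots$ generates the $k$-algebra $A$. $A$ is *finitely $\sigma$-presented* if it is isomorphic, as a difference $k$-algebra, to $k\{x_1,\dots,x_n\}/I$ for some $n\ge 0$, where $k\{x_1,\dots,x_n\}=k[\sigma^j(x_i): 1\le i\le n,\ j\ge 0]$ is the difference polynomial ring and $I$ is the ideal generated by $B\cup\sigma(B)\cup\sigma^2(B)\cup\cdots$ for some finite set $B\subseteq k\{x_1,\dots,x_n\}$. A *difference profinite space* is a profinite space $X$ with a continuous map $\sigma_X\colon X\to X$. A *subshift* is a difference profinite space isomorphic to a closed subset of $E^{\mathbb N}$, stable under the shift $(x_0,x_1,\dots)\mapsto(x_1,x_2,\dots)$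 and equipped with it, for some finite discrete set $E$. A *subshift of finite type* is a difference profinite space isomorphic to the space $\{x\in E^{\mathbb N}: s(x_{i+1})=t(x_i)\text{ for all }i\}$ of infinite paths, with the shift, of some finite directed graph with edge set $E$, source map $s$ and target map $t$. (Isomorphisms are homeomorphisms commuting with the self-maps.) **Theorem (Translation mechanism).** Let $(k,\sigma)$ be a difference field, let $\bar k$ be a separable closure of the field $k$, and let $\bar\sigma\colon\bar k\to\bar k$ be a ring endomorphism extending $\sigma$. Let $G=\mathrm{Gal}(\bar k/k)$ with the Krull topology and the continuous group endomorphism $g\mapsto g^{\sigma}$ determined by $\bar\sigma\circ g^{\sigma}=g\circ\bar\sigma$. For a difference locally étale $k$-algebra $A$ let $X(A)=\mathrm{Hom}_k(A,\bar k)$ be the set of $k$-algebra maps, with the profinite topology of pointwise convergence ($\bar k$ discrete), the continuous map $f\mapsto f^{\sigma}$ determined by $\bar\sigma\circ f^{\sigma}=f\circ\sigma_A$, and the action of $G$ by composition. Then $A\mapsto X(A)$, acting on morphisms by precomposition, is an anti-equivalence from the category of difference locally étale $k$-algebras to the category of difference profinite spaces $X$ with a continuous action of $G$ satisfying $\sigma_X(g\cdot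 x)=g^{\sigma}\cdot\sigma_X(x)$, whose morphisms are the continuous $G$-equivariant maps commuting with the self-maps. Moreover: 1. a morphism $A\to B$ of difference locally étale $k$-algebras is surjective if and only if $X(B)\to X(A)$ is injective; 2. a morphism $A\to B$ of difference locally étale $k$-algebras is injective if and only if $X(B)\to X(A)$ is surjective; 3. a difference locally étale $k$-algebra $A$ is finitely $\sigma$-generated if and only if $X(A)$ (without its $G$-action) is a subshift; 4. a difference locally étale $k$-algebra $A$ is finitely $\sigma$-presented if and only if $X(A)$ (without its $G$-action) is a subshift of finite type. -/

import Mathlib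

open CategoryTheory

universe u

namespace DifferenceGalois

noncomputable section

/-! ### Difference algebras over a difference field `(k, σ)` -/

/-- A difference algebra over the difference ring `(k, σ)`: a commutative unital `k`-algebra `A`
with a ring endomorphism such that the structure map `k → A` is a map of difference rings. The
zero ring is allowed. -/
structure DiffAlg {k : Type u} [Field k] (σ : k →+* k) : Type (u + 1) where
  carrier : Type u
  [commRing : CommRing carrier]
  [algebra : Algebra k carrier]
  sigma : carrier →+* carrier
  sigma_algebraMap : ∀ c : k, sigma (algebraMap k carrier c) = algebraMap k carrier (σ c)

attribute [instance] DiffAlg.commRing DiffAlg.algebra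

/-- Morphisms of difference algebras: `k`-algebra maps commuting with the endomorphisms. -/
@[ext]
structure DiffAlg.Hom {k : Type u} [Field k] {σ : k →+* k} (A B : DiffAlg σ) : Type u where
  toAlgHom : A.carrier →ₐ[k] B.carrier
  map_sigma : ∀ a, toAlgHom (A.sigma a) = B.sigma (toAlgHom a)

instance {k : Type u} [Field k] (σ : k →+* k) : Category.{u} (DiffAlg σ) where
  Hom A B := DiffAlg.Hom A B
  id A := ⟨AlgHom.id k A.carrier, fun _ => rfl⟩
  comp f g := ⟨g.toAlgHom.comp f.toAlgHom, fun a => by simp [f.map_sigma, g.map_sigma]⟩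

/-- An algebra over a field is locally étale if every element is a root of a separable polynomial
over the field. -/
def IsLocallyEtale (k A : Type u) [Field k] [CommRing A] [Algebra k A] : Prop :=
  ∀ a : A, ∃ p : Polynomial k, p.Separable ∧ Polynomial.aeval a p = 0

/-- A difference algebra over a difference field is difference locally étale if its underlying
algebra is locally étale. -/
abbrev IsDiffLocallyEtale {k : Type u} [Field k] (σ : k →+* k) : ObjectProperty (DiffAlg σ) :=
  fun A => IsLocallyEtale k A.carrier

/-- The full subcategory of difference locally étale algebras. -/
abbrev DiffLocEtaleAlg {k : Type u} [Field k] (σ : k →+* k) : Type (u + 1) :=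
  (IsDiffLocallyEtale σ).FullSubcategory

/-- `A` is finitely `σ`-generated: there is a finite `B ⊆ A` such that `A` is generated as a
`k`-algebra by `B, σ(B), σ²(B), …`. -/
def DiffAlg.FinSigmaGenerated {k : Type u} [Field k] {σ : k →+* k} (A : DiffAlg σ) : Prop :=
  ∃ B : Set A.carrier, B.Finite ∧
    Algebra.adjoin k {a | ∃ b ∈ B, ∃ j : ℕ, a = A.sigma^[j] b} = ⊤

/-- The difference polynomial ring `k{x₁, …, xₙ}`; the variable `(i, j)` stands for `σ^j(xᵢ)`. -/
abbrev DiffPoly (k : Type u) [Field k] (n : ℕ) : Type u := MvPolynomial (Fin n × ℕ) k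

/-- The endomorphism of `k{x₁, …, xₙ}`: it is `σ` on constants and maps `σ^j(xᵢ)` to
`σ^(j+1)(xᵢ)`. -/
def DiffPoly.sigma {k : Type u} [Field k] (σ : k →+* k) (n : ℕ) : DiffPoly k n →+* DiffPoly k n :=
  MvPolynomial.eval₂Hom (MvPolynomial.C.comp σ) (fun v => MvPolynomial.X (v.1, v.2 + 1))

/-- `A` is finitely `σ`-presented: it is a quotient of some `k{x₁, …, xₙ}`, as a difference
algebra, by an ideal generated by `B, σ(B), σ²(B), …` for some finite set `B`. -/
def DiffAlg.FinSigmaPresented {k : Type u} [Field k] {σ : k →+* k} (A : DiffAlg σ) : Prop :=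
  ∃ (n : ℕ) (π : DiffPoly k n →ₐ[k] A.carrier),
    Function.Surjective π ∧ (∀ p, π (DiffPoly.sigma σ n p) = A.sigma (π p)) ∧
    ∃ B : Set (DiffPoly k n), B.Finite ∧
      RingHom.ker π = Ideal.span {q | ∃ b ∈ B, ∃ j : ℕ, q = (DiffPoly.sigma σ n)^[j] b}

/-! ### Difference profinite spaces with a difference group action -/

/-- A difference profinite space with an action of the topological group `G` endowed with the
continuous endomorphism `s`: the action is continuous and `σ_X (g • x) = s g • σ_X x`. -/
structure DiffProfAction {G : Type u} [Group G] [TopologicalSpace G] (s : G →ₜ* G) :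
    Type (u + 1) where
  carrier : Type u
  [topologicalSpace : TopologicalSpace carrier]
  [compactSpace : CompactSpace carrier]
  [t2Space : T2Space carrier]
  [totallyDisconnectedSpace : TotallyDisconnectedSpace carrier]
  [mulAction : MulAction G carrier]
  [continuousSMul : ContinuousSMul G carrier]
  sigma : carrier → carrier
  continuous_sigma : Continuous sigma
  sigma_smul : ∀ (g : G) (x : carrier), sigma (g • x) = s g • sigma x

attribute [instance] DiffProfAction.topologicalSpace DiffProfAction.compactSpace
  DiffProfAction.t2Space DiffProfAction.totallyDisconnectedSpace DiffProfAction.mulAction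
  DiffProfAction.continuousSMul

/-- Morphisms: continuous `G`-equivariant maps commuting with the self-maps. -/
@[ext]
structure DiffProfAction.Hom {G : Type u} [Group G] [TopologicalSpace G] {s : G →ₜ* G}
    (X Y : DiffProfAction s) : Type u where
  toFun : X.carrier → Y.carrier
  continuous_toFun : Continuous toFun
  map_smul : ∀ (g : G) x, toFun (g • x) = g • toFun x
  map_sigma : ∀ x, toFun (X.sigma x) = Y.sigma (toFun x)

instance {G : Type u} [Group G] [TopologicalSpace G] (s : G →ₜ* G) :
    Category.{u} (DiffProfAction s) where
  Hom X Y := DiffProfAction.Hom X Y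
  id X := ⟨id, continuous_id, fun _ _ => rfl, fun _ => rfl⟩
  comp f g := ⟨g.toFun ∘ f.toFun, g.continuous_toFun.comp f.continuous_toFun,
    fun _ _ => by simp [f.map_smul, g.map_smul], fun _ => by simp [f.map_sigma, g.map_sigma]⟩

/-! ### Symbolic dynamics -/

/-- The one-sided shift on sequences. -/
def shift {E : Type} (x : ℕ → E) : ℕ → E := fun i => x (i + 1)

/-- The space `X` with self-map `s` is isomorphic, as a topological space with a self-map, to the
subset `S`, stable under the shift, of the full shift on `E`. -/
def IsIsoToShiftSubset {X : Type u} [TopologicalSpace X] (s : X → X)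
    {E : Type} [TopologicalSpace E] (S : Set (ℕ → E)) : Prop :=
  ∃ e : X ≃ₜ S, ∀ x, (e (s x) : ℕ → E) = shift (e x : ℕ → E)

/-- `(X, s)` is (isomorphic to) a subshift: a closed shift-stable subset of the full shift
on a finite discrete alphabet. -/
def IsSubshift {X : Type u} [TopologicalSpace X] (s : X → X) : Prop :=
  ∃ (E : Type) (_ : Finite E) (_ : TopologicalSpace E) (_ : DiscreteTopology E)
    (S : Set (ℕ → E)), IsClosed S ∧ Set.MapsTo shift S S ∧ IsIsoToShiftSubset s S

/-- The infinite paths in the directed graph with vertices `V`, edges `E`, and source and target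
maps `src`, `tgt`. -/
def pathSpace {V E : Type} (src tgt : E → V) : Set (ℕ → E) :=
  {x | ∀ i, src (x (i + 1)) = tgt (x i)}

/-- `(X, s)` is (isomorphic to) a subshift of finite type: the space of infinite paths of a finite
directed graph. -/
def IsSubshiftOfFiniteType {X : Type u} [TopologicalSpace X] (s : X → X) : Prop :=
  ∃ (V E : Type) (_ : Finite V) (_ : Finite E) (_ : TopologicalSpace E) (_ : DiscreteTopology E)
    (src tgt : E → V), IsIsoToShiftSubset s (pathSpace src tgt)

/-! ### Points with values in the separable closure -/

section Points

variable {k K : Type u} [Field k] [Field K] [Algebra k K]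

/-- The set `Hom_k(A, K)` (a copy, so as to carry the topology and the action below). -/
structure Points (k K : Type u) [Field k] [Field K] [Algebra k K]
    (A : Type u) [CommRing A] [Algebra k A] : Type u where
  toAlgHom : A →ₐ[k] K

/-- Evaluation of a point at an element of `A`. -/
def Points.eval {A : Type u} [CommRing A] [Algebra k A] (f : Points k K A) (a : A) : K :=
  f.toAlgHom a

variable {A : Type u} [CommRing A] [Algebra k A]

lemma Points.ext {f g : Points k K A} (h : ∀ a, f.eval a = g.eval a) : f = g := by
  obtain ⟨f⟩ := f
  obtain ⟨g⟩ := g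
  exact congrArg _ (AlgHom.ext h)

/-- The topology of pointwise convergence, `K` being discrete. When `A` is the union of a directed
family of finite-dimensional subalgebras `A_λ`, this is the limit topology of the finite discrete
spaces `Hom_k(A_λ, K)`. -/
instance : TopologicalSpace (Points k K A) :=
  TopologicalSpace.induced (fun f => f.eval) (@Pi.topologicalSpace A (fun _ => K) fun _ => ⊥)

lemma Points.isOpen_eval (a : A) (c : K) : IsOpen {f : Points k K A | f.eval a = c} := by
  let _ : TopologicalSpace K := ⊥
  have : DiscreteTopology K := ⟨rfl⟩
  have h : Continuous fun f : Points k K A => f.eval a :=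
    (continuous_apply a).comp continuous_induced_dom
  exact (isOpen_discrete {c}).preimage h

lemma Points.continuous_of {Y : Type u} [TopologicalSpace Y] {φ : Y → Points k K A}
    (h : ∀ a c, IsOpen {y | (φ y).eval a = c}) : Continuous φ := by
  let _ : TopologicalSpace K := ⊥
  have : DiscreteTopology K := ⟨rfl⟩
  refine continuous_induced_rng.2 (continuous_pi fun a => ?_)
  exact continuous_discrete_rng.2 fun c => h a c

instance : T2Space (Points k K A) := by
  let _ : TopologicalSpace K := ⊥
  have : DiscreteTopology K := ⟨rfl⟩
  have hc : Continuous fun f : Points k K A => f.eval := continuous_induced_dom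
  exact T2Space.of_injective_continuous
    (fun f g h => Points.ext fun a => congrFun h a) hc

instance : TotallyDisconnectedSpace (Points k K A) := by
  let _ : TopologicalSpace K := ⊥
  have : DiscreteTopology K := ⟨rfl⟩
  have hc : Continuous fun f : Points k K A => f.eval := continuous_induced_dom
  refine ⟨fun s _ hs => ?_⟩
  have := (isTotallyDisconnected_of_totallyDisconnectedSpace
    ((fun f : Points k K A => f.eval) '' s)) _ le_rfl (hs.image _ hc.continuousOn)
  intro f hf g hg
  exact Points.ext fun a => congrFun (this ⟨f, hf, rfl⟩ ⟨g, hg, rfl⟩) a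

lemma Points.eval_isRoot (f : Points k K A) {a : A} {p : Polynomial k}
    (hp : Polynomial.aeval a p = 0) : Polynomial.aeval (f.eval a) p = 0 := by
  have := Polynomial.aeval_algHom_apply f.toAlgHom a p
  rw [hp, map_zero] at this
  exact this

lemma Points.compactSpace
    (hA : IsLocallyEtale k A) :
    CompactSpace (Points k K A) := by
  let _ : TopologicalSpace K := ⊥
  have : DiscreteTopology K := ⟨rfl⟩
  choose p hps hp using hA
  have hfin (a : A) : {c : K | Polynomial.aeval c (p a) = 0}.Finite := by
    have hne : (p a).map (algebraMap k K) ≠ 0 :=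
      (Polynomial.map_ne_zero_iff (algebraMap k K).injective).2 (hps a).ne_zero
    refine (Polynomial.finite_setOfPred_isRoot hne).subset fun c hc => ?_
    simpa [Polynomial.IsRoot, Polynomial.aeval_def, Polynomial.eval_map] using hc
  have hind : Topology.IsInducing fun f : Points k K A => f.eval := ⟨rfl⟩
  have hev (a : A) : Continuous fun x : A → K => x a := continuous_apply a
  have hcl : IsClosed (Set.range fun f : Points k K A => f.eval) := by
    have : (Set.range fun f : Points k K A => f.eval) =
        (⋂ c : k, {x : A → K | x (algebraMap k A c) = algebraMap k K c}) ∩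
        ((⋂ a : A, ⋂ b : A, {x : A → K | x (a + b) = x a + x b}) ∩
         (⋂ a : A, ⋂ b : A, {x : A → K | x (a * b) = x a * x b})) := by
      ext x
      simp only [Set.mem_range, Set.mem_inter_iff, Set.mem_iInter, Set.mem_ofPred_eq]
      constructor
      · rintro ⟨f, rfl⟩
        exact ⟨fun c => AlgHom.commutes f.toAlgHom c,
          fun a b => map_add f.toAlgHom a b, fun a b => map_mul f.toAlgHom a b⟩
      · rintro ⟨hc, ha, hm⟩
        refine ⟨⟨{ toFun := x, map_one' := ?_, map_mul' := hm, map_zero' := ?_, map_add' := ha,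
                    commutes' := hc }⟩, rfl⟩
        · simpa using hc 1
        · simpa using hc 0
    rw [this]
    refine (isClosed_iInter fun c => isClosed_eq (hev _) continuous_const).inter
      ((isClosed_iInter fun a => isClosed_iInter fun b =>
        isClosed_eq (hev _) ((hev a).add (hev b))).inter
      (isClosed_iInter fun a => isClosed_iInter fun b =>
        isClosed_eq (hev _) ((hev a).mul (hev b))))
  have hK : IsCompact (Set.univ.pi fun a : A => {c : K | Polynomial.aeval c (p a) = 0}) :=
    isCompact_univ_pi fun a => (hfin a).isCompact
  refine ⟨hind.isCompact_iff.2 ?_⟩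
  rw [Set.image_univ]
  refine hK.of_isClosed_subset hcl ?_
  rintro _ ⟨f, rfl⟩ a _
  exact f.eval_isRoot (hp a)

/-- `Gal(K/k)` acts on `Hom_k(A, K)` by composition. -/
instance : MulAction (K ≃ₐ[k] K) (Points k K A) where
  smul g f := ⟨(g : K →ₐ[k] K).comp f.toAlgHom⟩
  one_smul _ := rfl
  mul_smul _ _ _ := rfl

lemma Points.eval_smul (g : K ≃ₐ[k] K) (f : Points k K A) (a : A) :
    (g • f).eval a = g (f.eval a) := rfl

lemma isOpen_gal_apply [Algebra.IsIntegral k K] (x c : K) :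
    IsOpen {g : K ≃ₐ[k] K | g x = c} := by
  rw [isOpen_iff_mem_nhds]
  intro g hg
  have h : IsOpen ((fun t : K ≃ₐ[k] K => g⁻¹ * t) ⁻¹'
      (MulAction.stabilizer (K ≃ₐ[k] K) x : Set (K ≃ₐ[k] K))) :=
    (stabilizer_isOpen_of_isIntegral x).preimage (continuous_const_mul g⁻¹)
  refine Filter.mem_of_superset (h.mem_nhds (by simp [one_mem])) fun t ht => ?_
  have ht' : (g⁻¹ * t) x = x := ht
  have h2 : t x = g x := by
    have h3 : g ((g⁻¹ * t) x) = t x := by rw [← AlgEquiv.mul_apply, mul_inv_cancel_left]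
    rw [← h3, ht']
  exact h2.trans hg

instance [Algebra.IsIntegral k K] : ContinuousSMul (K ≃ₐ[k] K) (Points k K A) := by
  refine ⟨Points.continuous_of fun a c => ?_⟩
  rw [isOpen_iff_mem_nhds]
  rintro ⟨g, f⟩ hgf
  have hU : IsOpen ({g' : K ≃ₐ[k] K | g' (f.eval a) = c} ×ˢ
      {f' : Points k K A | f'.eval a = f.eval a}) :=
    (isOpen_gal_apply _ _).prod (Points.isOpen_eval _ _)
  refine Filter.mem_of_superset (hU.mem_nhds ⟨hgf, rfl⟩) ?_
  rintro ⟨g', f'⟩ ⟨h1, h2⟩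
  simp only [Set.mem_ofPred_eq] at h1 h2 ⊢
  rw [Points.eval_smul, h2, h1]

/-- Precomposition with an algebra map. -/
def Points.comap {B : Type u} [CommRing B] [Algebra k B] (φ : A →ₐ[k] B) (f : Points k K B) :
    Points k K A := ⟨f.toAlgHom.comp φ⟩

lemma Points.eval_comap {B : Type u} [CommRing B] [Algebra k B] (φ : A →ₐ[k] B)
    (f : Points k K B) (a : A) : (f.comap φ).eval a = f.eval (φ a) := rfl

/-! ### The self-map `f ↦ f^σ` determined by `σ_K ∘ f^σ = f ∘ σ_A` -/

variable [IsSepClosure k K] {σ : k →+* k} {τ : K →+* K}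

lemma exists_conj (hτ : ∀ c, τ (algebraMap k K c) = algebraMap k K (σ c))
    (s : A →+* A) (hs : ∀ c, s (algebraMap k A c) = algebraMap k A (σ c))
    (hA : IsLocallyEtale k A)
    (f : Points k K A) : ∃ f' : Points k K A, ∀ a, τ (f'.eval a) = f.eval (s a) := by
  have hmem (a : A) : ∃ c, τ c = f.eval (s a) := by
    obtain ⟨p, hps, hp⟩ := hA a
    have hsp : (p.map (algebraMap k K)).Splits :=
      haveI := IsSepClosure.sep_closed (k := k) (K := K)
      IsSepClosed.splits_codomain p hps
    have hsa : Polynomial.aeval (s a) (p.map σ) = 0 := by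
      have h1 := congrArg s hp
      rw [map_zero, Polynomial.aeval_def, Polynomial.hom_eval₂] at h1
      rw [Polynomial.aeval_def, Polynomial.eval₂_map]
      rwa [show (algebraMap k A).comp σ = s.comp (algebraMap k A) from
        RingHom.ext fun c => (hs c).symm]
    have hr := f.eval_isRoot hsa
    have hmap : (p.map σ).map (algebraMap k K) = (p.map (algebraMap k K)).map τ := by
      rw [Polynomial.map_map, Polynomial.map_map]
      congr 1
      exact RingHom.ext fun c => (hτ c).symm
    have hne : p.map (algebraMap k K) ≠ 0 :=
      (Polynomial.map_ne_zero_iff (algebraMap k K).injective).2 hps.ne_zero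
    have hroot : f.eval (s a) ∈ ((p.map (algebraMap k K)).map τ).roots := by
      rw [Polynomial.mem_roots ((Polynomial.map_ne_zero_iff τ.injective).2 hne), ← hmap,
        Polynomial.IsRoot, Polynomial.eval_map, ← Polynomial.aeval_def]
      exact hr
    rw [hsp.roots_map] at hroot
    obtain ⟨c, -, hc⟩ := Multiset.mem_map.1 hroot
    exact ⟨c, hc⟩
  choose c hc using hmem
  have hf (a : A) : f.eval a = f.toAlgHom a := rfl
  refine ⟨⟨{ toFun := c, map_one' := ?_, map_mul' := fun a b => ?_, map_zero' := ?_,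
              map_add' := fun a b => ?_, commutes' := fun r => ?_ }⟩, hc⟩ <;>
    apply τ.injective
  · rw [hc, hf, map_one, map_one, map_one]
  · simp only [hc, hf, map_mul]
  · simp only [hc, hf, map_zero]
  · simp only [hc, hf, map_add]
  · rw [hc, hs, hτ, hf, AlgHom.commutes]

/-- `f^σ`, the unique point with `σ_K ∘ f^σ = f ∘ σ_A`. -/
def Points.conj (hτ : ∀ c, τ (algebraMap k K c) = algebraMap k K (σ c))
    (s : A →+* A) (hs : ∀ c, s (algebraMap k A c) = algebraMap k A (σ c))
    (hA : IsLocallyEtale k A)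
    (f : Points k K A) : Points k K A := (exists_conj hτ s hs hA f).choose

section

variable (hτ : ∀ c, τ (algebraMap k K c) = algebraMap k K (σ c))
    (s : A →+* A) (hs : ∀ c, s (algebraMap k A c) = algebraMap k A (σ c))
    (hA : IsLocallyEtale k A)

lemma Points.eval_conj (f : Points k K A) (a : A) :
    τ ((f.conj hτ s hs hA).eval a) = f.eval (s a) := (exists_conj hτ s hs hA f).choose_spec a

lemma Points.conj_unique (f f' : Points k K A) (h : ∀ a, τ (f'.eval a) = f.eval (s a)) :
    f' = f.conj hτ s hs hA :=
  Points.ext fun a => τ.injective (by rw [h, Points.eval_conj])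

lemma Points.continuous_conj : Continuous (Points.conj (K := K) hτ s hs hA) := by
  refine Points.continuous_of fun a c => ?_
  have : {f : Points k K A | (f.conj hτ s hs hA).eval a = c} =
      {f : Points k K A | f.eval (s a) = τ c} := by
    ext f
    simp only [Set.mem_ofPred_eq]
    rw [← Points.eval_conj hτ s hs hA]
    exact τ.injective.eq_iff.symm
  rw [this]
  exact Points.isOpen_eval _ _

end

/-! ### The difference Galois group -/

lemma locallyEtale_self (k K : Type u) [Field k] [Field K] [Algebra k K] [IsSepClosure k K]
    : IsLocallyEtale k K :=
  fun a => ⟨minpoly k a, Algebra.IsSeparable.isSeparable k a, minpoly.aeval k a⟩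

lemma exists_galConj (hτ : ∀ c, τ (algebraMap k K c) = algebraMap k K (σ c)) (g : K ≃ₐ[k] K) :
    ∃ g' : K ≃ₐ[k] K, ∀ x, τ (g' x) = g (τ x) := by
  have : Algebra.IsAlgebraic k K := inferInstance
  obtain ⟨f', hf'⟩ := exists_conj hτ τ hτ (locallyEtale_self k K)
    ⟨(g : K →ₐ[k] K)⟩
  exact ⟨AlgEquiv.ofBijective f'.toAlgHom (Algebra.IsAlgebraic.algHom_bijective _), hf'⟩

/-- The endomorphism `g ↦ g^σ` of `Gal(K/k)`, determined by `σ_K ∘ g^σ = g ∘ σ_K`. -/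
def galSigmaHom (hτ : ∀ c, τ (algebraMap k K c) = algebraMap k K (σ c)) :
    (K ≃ₐ[k] K) →* (K ≃ₐ[k] K) where
  toFun g := (exists_galConj hτ g).choose
  map_one' := AlgEquiv.ext fun x => τ.injective (by
    rw [(exists_galConj hτ 1).choose_spec]; rfl)
  map_mul' g h := AlgEquiv.ext fun x => τ.injective (by
    rw [(exists_galConj hτ (g * h)).choose_spec, AlgEquiv.mul_apply, AlgEquiv.mul_apply,
      (exists_galConj hτ g).choose_spec, (exists_galConj hτ h).choose_spec])

lemma galSigmaHom_spec (hτ : ∀ c, τ (algebraMap k K c) = algebraMap k K (σ c))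
    (g : K ≃ₐ[k] K) (x : K) : τ (galSigmaHom hτ g x) = g (τ x) :=
  (exists_galConj hτ g).choose_spec x

lemma continuous_galSigmaHom (hτ : ∀ c, τ (algebraMap k K c) = algebraMap k K (σ c)) :
    Continuous (galSigmaHom hτ) := by
  have : Algebra.IsAlgebraic k K := inferInstance
  have : Algebra.IsIntegral k K := inferInstance
  refine continuous_of_continuousAt_one _ ?_
  rw [ContinuousAt, map_one]
  refine Filter.tendsto_def.2 fun U hU => ?_
  obtain ⟨E, hE, hEU⟩ := (krullTopology_mem_nhds_one_iff k K U).1 hU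
  let b := Module.finBasis k E
  have hopen : IsOpen (⋂ i, {g : K ≃ₐ[k] K | g (τ (b i)) = τ (b i)}) :=
    isOpen_iInter_of_finite fun i => isOpen_gal_apply _ _
  refine Filter.mem_of_superset (hopen.mem_nhds (Set.mem_iInter.2 fun i => rfl)) fun g hg => ?_
  refine hEU fun x => ?_
  have hlin : (galSigmaHom hτ g).toLinearMap ∘ₗ E.val.toLinearMap = E.val.toLinearMap := by
    refine b.ext fun i => τ.injective ?_
    exact (galSigmaHom_spec hτ g _).trans (Set.mem_iInter.1 hg i)
  exact LinearMap.congr_fun hlin x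

/-- The continuous endomorphism `g ↦ g^σ` of `Gal(K/k)` with its Krull topology. -/
def galSigma (hτ : ∀ c, τ (algebraMap k K c) = algebraMap k K (σ c)) :
    (K ≃ₐ[k] K) →ₜ* (K ≃ₐ[k] K) :=
  { galSigmaHom hτ with continuous_toFun := continuous_galSigmaHom hτ }

lemma galSigma_spec (hτ : ∀ c, τ (algebraMap k K c) = algebraMap k K (σ c)) (g : K ≃ₐ[k] K)
    (x : K) : τ (galSigma hτ g x) = g (τ x) := galSigmaHom_spec hτ g x

/-! ### The functor `A ↦ (Hom_k(A, K), ()^σ)` -/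

/-- `X(A) = (Hom_k(A, K), ()^σ)` with its action of the difference Galois group. -/
def pointsObj (hτ : ∀ c, τ (algebraMap k K c) = algebraMap k K (σ c)) (A : DiffLocEtaleAlg σ) :
    DiffProfAction (galSigma hτ) :=
  have := Points.compactSpace (K := K) A.property
  { carrier := Points k K A.obj.carrier
    sigma := Points.conj hτ A.obj.sigma A.obj.sigma_algebraMap A.property
    continuous_sigma := Points.continuous_conj hτ _ _ _
    sigma_smul := fun g f => Eq.symm <| Points.conj_unique hτ _ _ _ _ _ fun a => by
      rw [Points.eval_smul, galSigma_spec, Points.eval_conj, Points.eval_smul] }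

/-- The functor `A ↦ X(A)`, contravariant by precomposition. -/
def pointsFunctor (hτ : ∀ c, τ (algebraMap k K c) = algebraMap k K (σ c)) :
    (DiffLocEtaleAlg σ)ᵒᵖ ⥤ DiffProfAction (galSigma hτ) where
  obj A := pointsObj hτ A.unop
  map {A B} φ :=
    { toFun := Points.comap φ.unop.hom.toAlgHom
      continuous_toFun := Points.continuous_of fun _ _ => Points.isOpen_eval _ _
      map_smul := fun _ _ => rfl
      map_sigma := fun f => Points.conj_unique hτ B.unop.obj.sigma B.unop.obj.sigma_algebraMap
        B.unop.property _ _ fun a =>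
        (Points.eval_conj hτ A.unop.obj.sigma A.unop.obj.sigma_algebraMap A.unop.property f _).trans
          (congrArg (Points.eval f) (φ.unop.hom.map_sigma a).symm) }
  map_id _ := rfl
  map_comp _ _ := rfl

end Points

end

end DifferenceGalois

open DifferenceGalois

/-!
The equivalence rests on describing a locally étale algebra `A` as the algebra of all locally
constant `Gal(K/k)`-equivariant functions on the profinite space `X(A)` of its points. The points
separate the elements of `A` because `A` is reduced with separable residue fields
(`IsLocallyEtale.exists_eval_ne_zero`). Conversely, the `K`-span of `A` is a point-separating algebra
of locally constant functions, hence contains all of them by a Stone–Weierstrass argument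
(`mem_of_separates`), and an equivariant function in the `K`-span of `A` lies in `A` by averaging with
an element of trace one (`mem_of_mem_span_of_equivariant`). In the other direction, a profinite
`Gal(K/k)`-space `X` has enough equivariant functions to separate its points
(`exists_equivariant_ne`, by linear independence of automorphisms), and every point of its function
algebra comes from `X`, since a closed stable set of points is the zero locus of an ideal
(`Points.exists_eval_ne_zero_of_notMem`). The same two facts give the criteria for surjectivity and
injectivity of algebra maps.

By the equation defining `f^σ`, the value of `f` at `σ^j(a)` is `τ^j` of the value of the `j`-th
iterate of `f` at `a`. So `σ`-generators of `A` are the same as elements whose values along orbits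
determine the points. Such values take finitely many letters, which gives a coding by a subshift;
conversely the first letter of a subshift factors through finitely many elements of `A`
(`exists_finite_factor`).

Finitely many `σ`-relations between the generators impose a clopen condition on all shifts of an
itinerary, and a higher block coding turns such a system into the path space of a finite graph
(`isSubshiftOfFiniteType_of_isClopen`). Conversely, subshifts of finite type are isolated from the
outside: if `X(A)` is one, then it contains every stable subset of a sufficiently small
neighbourhood of it in a larger expansive system (`exists_isOpen_isolating`). Applied to the points
of the algebra presented by separable equations for the generators, this shows that finitely many
further relations cut out `X(A)`, and they generate the whole ideal of relations because quotients
of locally étale algebras have enough points (`exists_finite_ker_eq_sigmaSpan`).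
-/

namespace DifferenceGalois

noncomputable section

/-! ### Stone–Weierstrass for locally constant functions -/

section LocallyConstant

variable {X K : Type*} [TopologicalSpace X] [CompactSpace X] [Field K]

/-- A locally constant function in the subalgebra has finitely many values, so that Lagrange
interpolation produces the indicator functions of its fibres. -/
lemma indicator_fiber_mem (S : Subalgebra K (X → K)) {s : X → K} (hs : s ∈ S)
    (hlc : IsLocallyConstant s) (c : K) : Set.indicator {x | s x = c} (1 : X → K) ∈ S := by
  classical
  have hfin := hlc.range_finite
  let q : Polynomial K := ∏ v ∈ hfin.toFinset.erase c, Polynomial.C (c - v)⁻¹ *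
    (Polynomial.X - Polynomial.C v)
  have hq : Set.indicator {x | s x = c} (1 : X → K) = Polynomial.aeval s q := by
    ext x
    have h1 : Polynomial.aeval s q x = q.eval (s x) := by
      have := Polynomial.aeval_algHom_apply (Pi.evalAlgHom K (fun _ : X => K) x) s q
      rw [← Polynomial.coe_aeval_eq_eval]
      exact this.symm
    rw [h1, Polynomial.eval_prod]
    by_cases hx : s x = c
    · rw [Set.indicator_of_mem (show x ∈ {x | s x = c} from hx)]
      symm
      refine Finset.prod_eq_one fun v hv => ?_
      have : c - v ≠ 0 := sub_ne_zero.2 (Finset.ne_of_mem_erase hv).symm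
      simp [hx, this]
    · rw [Set.indicator_of_notMem (show x ∉ {x | s x = c} from hx)]
      symm
      refine Finset.prod_eq_zero (i := s x) ?_ (by simp)
      simp [hx]
  rw [hq]
  exact (Polynomial.aeval_mem_adjoin_singleton K s |> fun h =>
    Algebra.adjoin_le (Set.singleton_subset_iff.2 hs) h)

/-- A Stone–Weierstrass theorem: a subalgebra of locally constant functions that separates the
points of a compact space contains every locally constant function. -/
theorem mem_of_separates (S : Subalgebra K (X → K)) (hlc : ∀ s ∈ S, IsLocallyConstant s)
    (hsep : ∀ x y, x ≠ y → ∃ s ∈ S, s x ≠ s y) {φ : X → K} (hφ : IsLocallyConstant φ) :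
    φ ∈ S := by
  classical
  -- The sets with indicator function in `S` form a Boolean algebra of clopen sets, which separates
  -- points and therefore, by compactness, contains every clopen set.
  let 𝓑 : Set (Set X) := {U | Set.indicator U (1 : X → K) ∈ S}
  have hcompl {U : Set X} (hU : U ∈ 𝓑) : Uᶜ ∈ 𝓑 := by
    change Set.indicator Uᶜ (1 : X → K) ∈ S
    rw [Set.indicator_compl]
    exact S.sub_mem S.one_mem hU
  have hinter {U V : Set X} (hU : U ∈ 𝓑) (hV : V ∈ 𝓑) : U ∩ V ∈ 𝓑 := by
    change Set.indicator (U ∩ V) (1 : X → K) ∈ S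
    rw [Set.inter_indicator_one]
    exact S.mul_mem hU hV
  have hunion {U V : Set X} (hU : U ∈ 𝓑) (hV : V ∈ 𝓑) : U ∪ V ∈ 𝓑 := by
    rw [← compl_compl (U ∪ V), Set.compl_union]
    exact hcompl (hinter (hcompl hU) (hcompl hV))
  have hempty : (∅ : Set X) ∈ 𝓑 := by
    change Set.indicator ∅ (1 : X → K) ∈ S
    rw [Set.indicator_empty]
    exact S.zero_mem
  have huniv : (Set.univ : Set X) ∈ 𝓑 := by simpa using hcompl hempty
  have hopen {U : Set X} (hU : U ∈ 𝓑) : IsOpen U := by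
    have : U = {x | Set.indicator U (1 : X → K) x = 1} := by
      ext x
      by_cases hx : x ∈ U <;> simp [hx]
    rw [this]
    exact (hlc _ hU).isOpen_fiber 1
  have hpair {x y : X} (hxy : x ≠ y) : ∃ U ∈ 𝓑, x ∈ U ∧ y ∉ U := by
    obtain ⟨s, hs, hne⟩ := hsep x y hxy
    exact ⟨_, indicator_fiber_mem S hs (hlc s hs) (s x), rfl, fun h => hne h.symm⟩
  have hpt {x : X} {T : Set X} (hT : IsCompact T) (hx : x ∉ T) :
      ∃ U ∈ 𝓑, x ∈ U ∧ Disjoint U T := by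
    refine hT.induction_on (p := fun T => ∃ U ∈ 𝓑, x ∈ U ∧ Disjoint U T)
      ⟨_, huniv, trivial, Set.disjoint_empty _⟩
      (fun T T' hTT' ⟨U, hU, hxU, hd⟩ => ⟨U, hU, hxU, hd.mono_right hTT'⟩) ?_ ?_
    · rintro T T' ⟨U, hU, hxU, hd⟩ ⟨U', hU', hxU', hd'⟩
      refine ⟨U ∩ U', hinter hU hU', ⟨hxU, hxU'⟩, Set.disjoint_union_right.2 ⟨?_, ?_⟩⟩
      · exact hd.mono_left Set.inter_subset_left
      · exact hd'.mono_left Set.inter_subset_right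
    · intro y hy
      obtain ⟨U, hU, hxU, hyU⟩ := hpair (fun h : x = y => hx (h ▸ hy))
      exact ⟨Uᶜ, mem_nhdsWithin_of_mem_nhds ((hopen (hcompl hU)).mem_nhds hyU), U, hU, hxU,
        disjoint_compl_right⟩
  have hclopen {U : Set X} (hU : IsClopen U) : U ∈ 𝓑 := by
    obtain ⟨V, hV, h1, h2⟩ : ∃ V ∈ 𝓑, U ⊆ V ∧ V ⊆ U := by
      refine hU.isClosed.isCompact.induction_on (p := fun T => ∃ V ∈ 𝓑, T ⊆ V ∧ V ⊆ U)
        ⟨∅, hempty, subset_rfl, Set.empty_subset _⟩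
        (fun T T' hTT' ⟨V, hV, h1, h2⟩ => ⟨V, hV, hTT'.trans h1, h2⟩) ?_ ?_
      · rintro T T' ⟨V, hV, h1, h2⟩ ⟨V', hV', h1', h2'⟩
        exact ⟨V ∪ V', hunion hV hV', Set.union_subset_union h1 h1', Set.union_subset h2 h2'⟩
      · intro x hx
        obtain ⟨V, hV, hxV, hd⟩ := hpt hU.compl.isClosed.isCompact (fun h : x ∈ Uᶜ => h hx)
        exact ⟨V, mem_nhdsWithin_of_mem_nhds ((hopen hV).mem_nhds hxV), V, hV, subset_rfl,
          Set.disjoint_compl_right_iff_subset.1 hd⟩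
    rwa [h1.antisymm h2]
  have hsum : φ = ∑ c ∈ hφ.range_finite.toFinset, c • Set.indicator {x | φ x = c} (1 : X → K) := by
    ext x
    rw [Finset.sum_apply, Finset.sum_eq_single (φ x)]
    · simp
    · intro c _ hc
      simp [Ne.symm hc]
    · simp
  rw [hsum]
  exact S.sum_mem fun c _ => S.smul_mem (hclopen (hφ.isClopen_fiber c)) c

end LocallyConstant

/-! ### Galois descent for equivariant functions -/

section Descent

variable {k K : Type*} [Field k] [Field K] [Algebra k K]

/-- Galois descent for spaces of equivariant functions. An equivariant `φ = ∑ cᵢ sᵢ` equals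
`∑ γ(cᵢ) sᵢ` for every automorphism `γ`; weighting these expressions by the conjugates of an
element of trace `1` and adding them up replaces the coefficients by traces. -/
theorem mem_of_mem_span_of_equivariant [IsGalois k K] {X : Type*} [MulAction (K ≃ₐ[k] K) X]
    (S : Submodule k (X → K)) (hS : ∀ s ∈ S, ∀ (g : K ≃ₐ[k] K) x, s (g • x) = g (s x))
    {φ : X → K} (hφ : ∀ (g : K ≃ₐ[k] K) x, φ (g • x) = g (φ x))
    (h : φ ∈ Submodule.span K (S : Set (X → K))) : φ ∈ S := by
  obtain ⟨n, c, s, rfl⟩ := Submodule.mem_span_set'.1 h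
  let L := FiniteGaloisIntermediateField.adjoin k (Set.range c)
  have hc (i : Fin n) : c i ∈ L.toIntermediateField :=
    FiniteGaloisIntermediateField.subset_adjoin k _ ⟨i, rfl⟩
  let c' (i : Fin n) : L := ⟨c i, hc i⟩
  obtain ⟨d, hd⟩ := Algebra.trace_surjective k L 1
  have key (γ : L ≃ₐ[k] L) (x : X) : (∑ i, c i • (s i : X → K)) x =
      ∑ i, algebraMap L K (γ (c' i)) * (s i : X → K) x := by
    let g := γ.liftNormal K
    have h1 : (∑ i, c i • (s i : X → K)) x = g ((∑ i, c i • (s i : X → K)) (g⁻¹ • x)) := by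
      rw [← hφ, smul_inv_smul]
    rw [h1, Finset.sum_apply, map_sum]
    refine Finset.sum_congr rfl fun i _ => ?_
    rw [Pi.smul_apply, smul_eq_mul, map_mul, ← hS _ (s i).2, smul_inv_smul]
    exact congrArg (· * _) (γ.liftNormal_commutes K (c' i))
  have hsum : ∑ i, c i • (s i : X → K) =
      ∑ i, Algebra.trace k L (d * c' i) • (s i : X → K) := by
    ext x
    have htr (l : L) : algebraMap k K (Algebra.trace k L l) =
        ∑ γ : L ≃ₐ[k] L, algebraMap L K (γ l) := by
      rw [IsScalarTower.algebraMap_apply k L K, trace_eq_sum_automorphisms, map_sum]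
    calc (∑ i, c i • (s i : X → K)) x
        = algebraMap k K (Algebra.trace k L d) * (∑ i, c i • (s i : X → K)) x := by
          rw [hd, map_one, one_mul]
      _ = ∑ γ : L ≃ₐ[k] L, ∑ i, algebraMap L K (γ (d * c' i)) * (s i : X → K) x := by
          rw [htr, Finset.sum_mul]
          refine Finset.sum_congr rfl fun γ _ => ?_
          rw [key γ, Finset.mul_sum]
          exact Finset.sum_congr rfl fun i _ => by rw [map_mul, map_mul, mul_assoc]
      _ = (∑ i, Algebra.trace k L (d * c' i) • (s i : X → K)) x := by
          rw [Finset.sum_comm, Finset.sum_apply]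
          refine Finset.sum_congr rfl fun i _ => ?_
          rw [Pi.smul_apply, Algebra.smul_def, htr, Finset.sum_mul]
  rw [hsum]
  exact S.sum_mem fun i _ => S.smul_mem _ (s i).2

/-- Combination of the Stone–Weierstrass theorem and Galois descent: a `k`-algebra of equivariant
locally constant functions that separates points contains all such functions. -/
theorem mem_of_separates_of_equivariant [IsGalois k K] {X : Type*} [TopologicalSpace X]
    [CompactSpace X] [MulAction (K ≃ₐ[k] K) X] (S : Subalgebra k (X → K))
    (hlc : ∀ s ∈ S, IsLocallyConstant s)
    (hS : ∀ s ∈ S, ∀ (g : K ≃ₐ[k] K) x, s (g • x) = g (s x))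
    (hsep : ∀ x y, x ≠ y → ∃ s ∈ S, s x ≠ s y) {φ : X → K} (hlcφ : IsLocallyConstant φ)
    (hφ : ∀ (g : K ≃ₐ[k] K) x, φ (g • x) = g (φ x)) : φ ∈ S := by
  refine mem_of_mem_span_of_equivariant (Subalgebra.toSubmodule S) hS hφ ?_
  have hcl : (Submonoid.closure (S : Set (X → K)) : Set (X → K)) = S :=
    congrArg SetLike.coe (Submonoid.closure_eq S.toSubmonoid)
  have hspan : (Algebra.adjoin K (S : Set (X → K))).toSubmodule =
      Submodule.span K (S : Set (X → K)) := by
    rw [Algebra.adjoin_eq_span, hcl]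
  change φ ∈ Submodule.span K (S : Set (X → K))
  rw [← hspan]
  refine mem_of_separates (Algebra.adjoin K (S : Set (X → K))) (fun s hs => ?_)
    (fun x y hxy => ?_) hlcφ
  · induction hs using Algebra.adjoin_induction with
    | mem s hs => exact hlc s hs
    | algebraMap c => exact IsLocallyConstant.const c
    | add s t _ _ hs ht => exact hs.comp₂ ht (· + ·)
    | mul s t _ _ hs ht => exact hs.comp₂ ht (· * ·)
  · obtain ⟨s, hs, h⟩ := hsep x y hxy
    exact ⟨s, Algebra.subset_adjoin hs, h⟩

end Descent

/-! ### Locally étale algebras -/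

section LocallyEtale

/-- Finitely many separable irreducible polynomials have a common separable multiple, the product
of the distinct ones. -/
lemma exists_separable_dvd {k : Type*} [Field k] {T : Set (Polynomial k)} (hT : T.Finite)
    (hm : ∀ p ∈ T, p.Monic) (hi : ∀ p ∈ T, Irreducible p) (hs : ∀ p ∈ T, p.Separable) :
    ∃ P : Polynomial k, P.Separable ∧ ∀ p ∈ T, p ∣ P := by
  refine ⟨∏ p ∈ hT.toFinset, p, Polynomial.separable_prod' (fun p hp q hq hpq => ?_)
    (fun p hp => hs p (hT.mem_toFinset.1 hp)),
    fun p hp => Finset.dvd_prod_of_mem _ (hT.mem_toFinset.2 hp)⟩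
  rw [hT.mem_toFinset] at hp hq
  refine (hi p hp).coprime_iff_not_dvd.2 fun h => hpq ?_
  exact Polynomial.eq_of_monic_of_associated (hm p hp) (hm q hq)
    ((hi p hp).associated_of_dvd (hi q hq) h)

variable {k A : Type u} [Field k] [CommRing A] [Algebra k A]

lemma IsLocallyEtale.isIntegral (hA : IsLocallyEtale k A) : Algebra.IsIntegral k A := by
  refine ⟨fun a => ?_⟩
  obtain ⟨p, hps, hp⟩ := hA a
  exact isAlgebraic_iff_isIntegral.1 ⟨p, hps.ne_zero, hp⟩

lemma IsLocallyEtale.of_surjective {B : Type u} [CommRing B] [Algebra k B]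
    (hA : IsLocallyEtale k A) (f : A →ₐ[k] B) (hf : Function.Surjective f) :
    IsLocallyEtale k B := by
  intro b
  obtain ⟨a, rfl⟩ := hf b
  obtain ⟨p, hps, hp⟩ := hA a
  exact ⟨p, hps, by rw [Polynomial.aeval_algHom_apply, hp, map_zero]⟩

/-- The minimal polynomial of a nilpotent `a` is squarefree and divides a power of `X`. -/
lemma IsLocallyEtale.isReduced (hA : IsLocallyEtale k A) : IsReduced A := by
  refine ⟨fun a ⟨n, hn⟩ => ?_⟩
  obtain ⟨p, hps, hp⟩ := hA a
  have hsq : Squarefree (minpoly k a) := hps.squarefree.squarefree_of_dvd (minpoly.dvd k a hp)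
  have h1 : minpoly k a ∣ Polynomial.X ^ (n + 1) :=
    minpoly.dvd k a (by simp [pow_succ, hn])
  obtain ⟨q, hq⟩ := (hsq.dvd_pow_iff_dvd n.succ_ne_zero).1 h1
  have h2 := congrArg (Polynomial.aeval a) hq
  rwa [map_mul, minpoly.aeval, zero_mul, Polynomial.aeval_X] at h2

/-- The points with values in a separable closure separate the elements of a locally étale
algebra. -/
theorem IsLocallyEtale.exists_eval_ne_zero {K : Type u} [Field K] [Algebra k K]
    [IsSepClosure k K] (hA : IsLocallyEtale k A) {a : A} (ha : a ≠ 0) :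
    ∃ f : Points k K A, f.eval a ≠ 0 := by
  have := hA.isReduced
  have := hA.isIntegral
  have hnil : a ∉ nilradical A := by rwa [nilradical_eq_zero, Submodule.zero_eq_bot, Ideal.mem_bot]
  obtain ⟨P, hP, haP⟩ : ∃ P : Ideal A, P.IsPrime ∧ a ∉ P := by
    rw [nilradical_eq_sInf, Submodule.mem_sInf] at hnil
    simpa only [not_forall, exists_prop, Set.mem_ofPred_eq] using hnil
  have hmax : P.IsMaximal := Ideal.isMaximal_of_isIntegral_of_isMaximal_comap (R := k) P
    (by
      have : (P.comap (algebraMap k A)) = ⊥ :=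
        (Ideal.eq_bot_or_top _).resolve_right (Ideal.comap_ne_top _ hP.ne_top)
      rw [this]
      exact Ideal.bot_isMaximal)
  let _ : Field (A ⧸ P) := Ideal.Quotient.field P
  have hsep : Algebra.IsSeparable k (A ⧸ P) := by
    refine ⟨fun x => ?_⟩
    obtain ⟨a, rfl⟩ := Ideal.Quotient.mk_surjective x
    obtain ⟨p, hps, hp⟩ := hA a
    refine hps.of_dvd (minpoly.dvd k _ ?_)
    have := Polynomial.aeval_algHom_apply (Ideal.Quotient.mkₐ k P) a p
    rw [hp, map_zero] at this
    exact this
  have := IsSepClosure.sep_closed (k := k) (K := K)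
  let i : (A ⧸ P) →ₐ[k] K := IsSepClosed.lift
  refine ⟨⟨i.comp (Ideal.Quotient.mkₐ k P)⟩, fun h => haP ?_⟩
  have h' : i (Ideal.Quotient.mk P a) = 0 := h
  exact Ideal.Quotient.eq_zero_iff_mem.1 ((map_eq_zero i).1 h')

lemma IsLocallyEtale.eq_of_eval_eq {K : Type u} [Field K] [Algebra k K]
    [IsSepClosure k K] (hA : IsLocallyEtale k A) {a b : A}
    (h : ∀ f : Points k K A, f.eval a = f.eval b) : a = b := by
  by_contra hab
  obtain ⟨f, hf⟩ := hA.exists_eval_ne_zero (K := K) (sub_ne_zero.2 hab)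
  exact hf ((map_sub f.toAlgHom a b).trans (sub_eq_zero.2 (h f)))

/-- Elements annihilated by separable polynomials generate a formally unramified algebra: their
differentials vanish because `p'(a)` is invertible whenever `p(a) = 0`. -/
lemma formallyUnramified_of_adjoin {T : Set A} (hT : Algebra.adjoin k T = ⊤)
    (h : ∀ a ∈ T, ∃ p : Polynomial k, p.Separable ∧ Polynomial.aeval a p = 0) :
    Algebra.FormallyUnramified k A := by
  rw [Algebra.formallyUnramified_iff]
  have hD : KaehlerDifferential.D k A = 0 := by
    refine Derivation.ext_of_adjoin_eq_top T hT fun a ha => ?_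
    obtain ⟨p, ⟨u, v, huv⟩, hp⟩ := h a ha
    have h1 := (KaehlerDifferential.D k A).map_aeval p a
    rw [hp, map_zero] at h1
    have h2 := congrArg (Polynomial.aeval a) huv
    rw [map_add, map_mul, map_mul, hp, mul_zero, zero_add, map_one] at h2
    rw [Derivation.zero_apply, ← one_smul A (KaehlerDifferential.D k A a), ← h2, mul_smul, ← h1,
      smul_zero]
  have hspan := KaehlerDifferential.span_range_derivation k A
  refine ⟨fun x y => ?_⟩
  have hz (x : Ω[A⁄k]) : x = 0 := by
    have hx : x ∈ Submodule.span A (Set.range (KaehlerDifferential.D k A)) := hspan ▸ trivial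
    have h0 : Set.range (KaehlerDifferential.D k A) ⊆ {0} := by
      rintro _ ⟨a, rfl⟩
      rw [hD]
      rfl
    rw [Submodule.span_eq_bot.2 h0] at hx
    exact hx
  rw [hz x, hz y]

/-- A formally unramified algebra of finite type is a finite product of finite separable
extensions. -/
lemma isLocallyEtale_of_formallyUnramified [Algebra.FiniteType k A]
    [Algebra.FormallyUnramified k A] : IsLocallyEtale k A := by
  have := Algebra.FormallyEtale.of_formallyUnramified_of_field k A
  obtain ⟨I, _, L, _, _, e, hsep⟩ := (Algebra.FormallyEtale.iff_exists_algEquiv_prod k A).1 this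
  intro a
  obtain ⟨P, hPs, hP⟩ := exists_separable_dvd (Set.finite_range fun i => minpoly k (e a i))
    (by rintro _ ⟨i, rfl⟩; exact minpoly.monic (Algebra.IsSeparable.isIntegral k _))
    (by rintro _ ⟨i, rfl⟩; exact minpoly.irreducible (Algebra.IsSeparable.isIntegral k _))
    (by rintro _ ⟨i, rfl⟩; exact Algebra.IsSeparable.isSeparable k _)
  refine ⟨P, hPs, e.injective (funext fun i => ?_)⟩
  rw [map_zero, ← AlgEquiv.coe_toAlgHom, ← Polynomial.aeval_algHom_apply]
  have h1 := Polynomial.aeval_algHom_apply (Pi.evalAlgHom k L i) (e a) P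
  refine h1.symm.trans ?_
  obtain ⟨Q, hQ⟩ := hP _ ⟨i, rfl⟩
  change Polynomial.aeval (e a i) P = 0
  rw [hQ, map_mul, minpoly.aeval, zero_mul]

/-- An algebra generated by roots of separable polynomials is locally étale. -/
theorem isLocallyEtale_of_adjoin {T : Set A} (hT : Algebra.adjoin k T = ⊤)
    (h : ∀ a ∈ T, ∃ p : Polynomial k, p.Separable ∧ Polynomial.aeval a p = 0) :
    IsLocallyEtale k A := by
  -- Sums and products of two such elements lie in the algebra generated by them, which is of finite
  -- type and formally unramified.
  have key {a b : A} (ha : ∃ p : Polynomial k, p.Separable ∧ Polynomial.aeval a p = 0)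
      (hb : ∃ p : Polynomial k, p.Separable ∧ Polynomial.aeval b p = 0) {c : A}
      (hc : c ∈ Algebra.adjoin k {a, b}) :
      ∃ p : Polynomial k, p.Separable ∧ Polynomial.aeval c p = 0 := by
    let D := Algebra.adjoin k {a, b}
    have hfg : Algebra.FiniteType k D :=
      D.fg_iff_finiteType.1 (⟨(Set.toFinite {a, b}).toFinset, by simp [D]⟩)
    have hun : Algebra.FormallyUnramified k D := by
      refine formallyUnramified_of_adjoin (T := D.val ⁻¹' {a, b}) ?_ ?_
      · exact Algebra.adjoin_adjoin_coe_preimage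
      · rintro d (hd : (d : A) = a ∨ (d : A) = b)
        have : ∃ p : Polynomial k, p.Separable ∧ Polynomial.aeval (d : A) p = 0 := by
          rcases hd with hd | hd <;> rw [hd] <;> assumption
        obtain ⟨p, hps, hp⟩ := this
        refine ⟨p, hps, Subtype.val_injective ?_⟩
        exact (Polynomial.aeval_algHom_apply D.val d p).symm.trans hp
    obtain ⟨p, hps, hp⟩ := isLocallyEtale_of_formallyUnramified (k := k) (A := D) ⟨c, hc⟩
    refine ⟨p, hps, ?_⟩
    have := Polynomial.aeval_algHom_apply D.val ⟨c, hc⟩ p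
    rwa [hp, map_zero] at this
  intro c
  have hc : c ∈ Algebra.adjoin k T := hT ▸ trivial
  induction hc using Algebra.adjoin_induction with
  | mem a ha => exact h a ha
  | algebraMap r =>
    exact ⟨Polynomial.X - Polynomial.C r, Polynomial.separable_X_sub_C, by simp⟩
  | add a b _ _ ha hb =>
    exact key ha hb (add_mem (Algebra.subset_adjoin (by simp)) (Algebra.subset_adjoin (by simp)))
  | mul a b _ _ ha hb =>
    exact key ha hb (mul_mem (Algebra.subset_adjoin (by simp)) (Algebra.subset_adjoin (by simp)))

end LocallyEtale

/-! ### Galois orbits of points -/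

section PointsOfLocallyEtale

variable {k K A : Type u} [Field k] [Field K] [Algebra k K] [CommRing A] [Algebra k A]

lemma Points.isLocallyConstant_eval (a : A) :
    IsLocallyConstant fun f : Points k K A => f.eval a :=
  IsLocallyConstant.iff_isOpen_fiber.2 fun c => Points.isOpen_eval a c

/-- Two points with comparable kernels are conjugate: the second factors through the image of the
first, a subfield of the normal extension `K`. -/
theorem Points.exists_smul_eq [Normal k K] {f f' : Points k K A}
    (h : ∀ a, f.eval a = 0 → f'.eval a = 0) : ∃ g : K ≃ₐ[k] K, g • f = f' := by
  let L : IntermediateField k K := f.toAlgHom.range.toIntermediateField' <|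
    Subalgebra.isField_of_algebraic _
  let π : A →ₐ[k] L := f.toAlgHom.rangeRestrict
  have hπ : Function.Surjective π := f.toAlgHom.rangeRestrict_surjective
  let φ : L →ₐ[k] K := AlgHom.liftOfSurjective π hπ f'.toAlgHom fun a ha =>
    h a (congrArg (algebraMap L K) ha)
  have hφ (a : A) : φ (π a) = f'.eval a := AlgHom.liftOfSurjective_apply _ _ _ _ a
  let ψ : K →ₐ[k] K := φ.liftNormal K
  refine ⟨AlgEquiv.ofBijective ψ (Algebra.IsAlgebraic.algHom_bijective _), Points.ext fun a => ?_⟩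
  rw [Points.eval_smul, ← hφ]
  exact φ.liftNormal_commutes K (π a)

/-- A compact set of points stable under the Galois group is the zero locus of an ideal. No point of
`Z` is conjugate to `f`, so that each is a zero of some element that does not vanish at `f`; the
required element is a product of finitely many of these. -/
theorem Points.exists_eval_ne_zero_of_notMem [Normal k K] {Z : Set (Points k K A)}
    (hZ : IsCompact Z) (hG : ∀ (g : K ≃ₐ[k] K), ∀ f ∈ Z, g • f ∈ Z) {f : Points k K A}
    (hf : f ∉ Z) : ∃ a : A, (∀ z ∈ Z, z.eval a = 0) ∧ f.eval a ≠ 0 := by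
  refine hZ.induction_on (p := fun Z => ∃ a : A, (∀ z ∈ Z, z.eval a = 0) ∧ f.eval a ≠ 0)
    ⟨1, by simp, by simp [Points.eval]⟩ (fun s t hst ⟨a, ha, hfa⟩ =>
      ⟨a, fun z hz => ha z (hst hz), hfa⟩) ?_ ?_
  · rintro s t ⟨a, ha, hfa⟩ ⟨b, hb, hfb⟩
    have hmul (z : Points k K A) : z.eval (a * b) = z.eval a * z.eval b := map_mul z.toAlgHom a b
    refine ⟨a * b, fun z hz => ?_, ?_⟩
    · rw [hmul]
      rcases hz with hz | hz
      · rw [ha z hz, zero_mul]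
      · rw [hb z hz, mul_zero]
    · rw [hmul]
      exact mul_ne_zero hfa hfb
  · intro z hz
    have : ∃ a, z.eval a = 0 ∧ f.eval a ≠ 0 := by
      by_contra! hcon
      obtain ⟨g, rfl⟩ := Points.exists_smul_eq hcon
      exact hf (hG g z hz)
    obtain ⟨a, ha, hfa⟩ := this
    exact ⟨{z | z.eval a = 0}, mem_nhdsWithin_of_mem_nhds ((Points.isOpen_eval a 0).mem_nhds ha),
      a, fun _ h => h, hfa⟩

end PointsOfLocallyEtale

/-! ### Equivariant functions on a profinite space -/

section EquivariantFunctions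

variable (k K X : Type u) [Field k] [Field K] [Algebra k K] [TopologicalSpace X]
  [MulAction (K ≃ₐ[k] K) X]

/-- The `k`-algebra of locally constant `Gal(K/k)`-equivariant functions `X → K`. -/
def equivariantFunctions : Subalgebra k (X → K) where
  carrier := {φ | IsLocallyConstant φ ∧ ∀ (g : K ≃ₐ[k] K) x, φ (g • x) = g (φ x)}
  mul_mem' := fun ha hb => ⟨ha.1.comp₂ hb.1 (· * ·), fun g x => by simp [ha.2, hb.2]⟩
  add_mem' := fun ha hb => ⟨ha.1.comp₂ hb.1 (· + ·), fun g x => by simp [ha.2, hb.2]⟩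
  algebraMap_mem' := fun c => ⟨IsLocallyConstant.const _, fun g x => by simp⟩

variable {k K X}

/-- An equivariant function is annihilated by the product of the distinct minimal polynomials of
its finitely many values. -/
lemma isLocallyEtale_equivariantFunctions [CompactSpace X] [IsSepClosure k K] :
    IsLocallyEtale k (equivariantFunctions k K X) := by
  rintro ⟨φ, hφ⟩
  have hint (c : K) : IsIntegral k c := Algebra.IsSeparable.isIntegral k c
  obtain ⟨P, hPs, hP⟩ := exists_separable_dvd (hφ.1.range_finite.image (minpoly k))
    (by rintro _ ⟨c, -, rfl⟩; exact minpoly.monic (hint c))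
    (by rintro _ ⟨c, -, rfl⟩; exact minpoly.irreducible (hint c))
    (by rintro _ ⟨c, -, rfl⟩; exact Algebra.IsSeparable.isSeparable k c)
  refine ⟨P, hPs, Subtype.val_injective (funext fun x => ?_)⟩
  have h1 := Polynomial.aeval_algHom_apply
    ((Pi.evalAlgHom k (fun _ : X => K) x).comp (equivariantFunctions k K X).val) ⟨φ, hφ⟩ P
  refine h1.symm.trans ?_
  obtain ⟨Q, hQ⟩ := hP _ ⟨φ x, ⟨x, rfl⟩, rfl⟩
  change Polynomial.aeval (φ x) P = 0
  rw [hQ, map_mul, minpoly.aeval, zero_mul]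

/-- A clopen subset of a compact space with a continuous action of the Galois group is stable
under the automorphisms fixing some finite normal subextension. -/
lemma exists_fixingSubgroup_smul_mem_iff [CompactSpace X] [Normal k K]
    [ContinuousSMul (K ≃ₐ[k] K) X] {U : Set X} (hU : IsClopen U) :
    ∃ E : IntermediateField k K, FiniteDimensional k E ∧ Normal k E ∧
      ∀ g ∈ E.fixingSubgroup, ∀ z : X, g • z ∈ U ↔ z ∈ U := by
  let W : Set ((K ≃ₐ[k] K) × X) := {p | p.1 • p.2 ∈ U ↔ p.2 ∈ U}
  have hW : IsOpen W := by
    have h1 : IsClopen {p : (K ≃ₐ[k] K) × X | p.1 • p.2 ∈ U} := hU.preimage continuous_smul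
    have h2 : IsClopen {p : (K ≃ₐ[k] K) × X | p.2 ∈ U} := hU.preimage continuous_snd
    have h3 : W = ({p | p.1 • p.2 ∈ U} ∩ {p | p.2 ∈ U}) ∪
        ({p | p.1 • p.2 ∈ U}ᶜ ∩ {p | p.2 ∈ U}ᶜ) := by
      ext p
      simp only [W, Set.mem_ofPred_eq, Set.mem_union, Set.mem_inter_iff, Set.mem_compl_iff]
      tauto
    rw [h3]
    exact ((h1.inter h2).union (h1.compl.inter h2.compl)).isOpen
  obtain ⟨V, V', hV, -, h1V, hV', hVW⟩ := generalized_tube_lemma (isCompact_singleton (x := 1))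
    (isCompact_univ (X := X)) hW (by rintro ⟨g, z⟩ ⟨rfl, -⟩; simp [W])
  obtain ⟨E, hEfin, hEn, hE⟩ := (krullTopology_mem_nhds_one_iff_of_normal k K V).1
    (hV.mem_nhds (h1V rfl))
  exact ⟨E, hEfin, hEn, fun g hg z =>
    hVW (Set.mk_mem_prod (hE hg) (hV' (Set.mem_univ z)))⟩

/-- Equivariant functions separate the points of a profinite space. For a clopen set `U` that
separates `x` from `y` and is stable under the automorphisms fixing a finite Galois extension `E`,
the functions `z ↦ ∑ γ(c) 1_U(γ⁻¹ z)` with `c ∈ E` are equivariant. If all of them agreed at `x` and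
`y`, then `1_U(γ⁻¹ x) = 1_U(γ⁻¹ y)` for all `γ` by the linear independence of automorphisms. -/
theorem exists_equivariant_ne [CompactSpace X] [T2Space X] [TotallyDisconnectedSpace X]
    [IsGalois k K] [ContinuousSMul (K ≃ₐ[k] K) X] {x y : X} (hxy : x ≠ y) :
    ∃ φ ∈ equivariantFunctions k K X, φ x ≠ φ y := by
  classical
  obtain ⟨U, hU, hxU, hyU⟩ := exists_isClopen_of_totally_separated hxy
  obtain ⟨E, hEfin, hEn, hE⟩ := exists_fixingSubgroup_smul_mem_iff (k := k) (K := K) hU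
  let ψ (g : K ≃ₐ[k] K) (z : X) : K := Set.indicator U 1 (g⁻¹ • z)
  have hψlc (g : K ≃ₐ[k] K) : IsLocallyConstant (ψ g) := by
    have h : IsLocallyConstant (Set.indicator U (1 : X → K)) :=
      LocallyConstant.coe_charFn K hU ▸ (LocallyConstant.charFn K hU).isLocallyConstant
    exact h.comp_continuous (continuous_const_smul g⁻¹)
  have hψ {g h : K ≃ₐ[k] K} (hgh : AlgEquiv.restrictNormalHom E g = AlgEquiv.restrictNormalHom E h)
      (z : X) : ψ g z = ψ h z := by
    have hmem : g⁻¹ * h ∈ E.fixingSubgroup := by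
      rw [← IntermediateField.restrictNormalHom_ker, MonoidHom.mem_ker, map_mul, map_inv, hgh,
        inv_mul_cancel]
    have h1 := hE _ hmem (h⁻¹ • z)
    rw [smul_smul, mul_assoc, mul_inv_cancel, mul_one] at h1
    simp only [ψ, Set.indicator_apply, h1, Pi.one_apply]
  have hψ01 (g h : K ≃ₐ[k] K) (z : X) : h (ψ g z) = ψ g z := by
    by_cases hz : g⁻¹ • z ∈ U <;> simp [ψ, hz]
  let l (γ : E ≃ₐ[k] E) : K ≃ₐ[k] K := γ.liftNormal K
  have hl (γ : E ≃ₐ[k] E) : AlgEquiv.restrictNormalHom E (l γ) = γ := γ.restrict_liftNormal K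
  let φ (c : E) (z : X) : K := ∑ γ : E ≃ₐ[k] E, algebraMap E K (γ c) * ψ (l γ) z
  have hφ (c : E) : φ c ∈ equivariantFunctions k K X := by
    refine ⟨?_, fun h z => ?_⟩
    · have : φ c = ∑ γ : E ≃ₐ[k] E, fun z => algebraMap E K (γ c) * ψ (l γ) z := by
        ext z
        rw [Finset.sum_apply]
      rw [this]
      exact Finset.sum_induction _ IsLocallyConstant (fun _ _ ha hb => ha.comp₂ hb (· + ·))
        (IsLocallyConstant.const 0) fun γ _ => (hψlc (l γ)).comp fun t => algebraMap E K (γ c) * t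
    · let h' := AlgEquiv.restrictNormalHom E h
      rw [map_sum]
      refine Fintype.sum_equiv (Equiv.mulLeft h'⁻¹) _ _ fun γ => ?_
      rw [map_mul, hψ01, Equiv.coe_mulLeft]
      congr 1
      · have h1 := AlgEquiv.restrictNormal_commutes h E ((h'⁻¹ * γ) c)
        rw [← h1]
        congr 1
        change γ c = h' ((h'⁻¹ * γ) c)
        rw [← AlgEquiv.mul_apply, mul_inv_cancel_left]
      · have h2 : ψ (l γ) (h • z) = ψ (h⁻¹ * l γ) z := by
          simp only [ψ, mul_inv_rev, inv_inv, mul_smul]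
        rw [h2]
        refine hψ ?_ z
        rw [map_mul, map_inv, hl, hl]
  by_contra! hcon
  have hli := (linearIndependent_toLinearMap k E K).comp
    (fun γ : E ≃ₐ[k] E => (IsScalarTower.toAlgHom k E K).comp (γ : E →ₐ[k] E)) (fun γ γ' h =>
      AlgEquiv.ext fun c => (algebraMap E K).injective (AlgHom.congr_fun h c))
  have hzero := Fintype.linearIndependent_iff.1 hli (fun γ => ψ (l γ) x - ψ (l γ) y) (by
    ext c
    have h1 := hcon (φ c) (hφ c)
    rw [← sub_eq_zero] at h1
    rw [LinearMap.sum_apply, LinearMap.zero_apply, ← h1]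
    simp only [φ]
    rw [← Finset.sum_sub_distrib]
    refine Finset.sum_congr rfl fun γ _ => ?_
    rw [← mul_sub, mul_comm]
    rfl) 1
  rw [hψ (h := 1) ((hl 1).trans (map_one _).symm), hψ (h := 1) ((hl 1).trans (map_one _).symm)]
    at hzero
  have hyU' : y ∉ U := hyU
  simp [ψ, hxU, hyU'] at hzero

end EquivariantFunctions

/-! ### Algebras as equivariant functions on their points -/

section Evaluation

variable {k K A : Type u} [Field k] [Field K] [Algebra k K] [CommRing A] [Algebra k A]

/-- An algebra map that induces an injection on points has every equivariant function on the
points of its target in its image. -/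
theorem exists_eval_comp_eq [IsSepClosure k K] {B : Type u} [CommRing B] [Algebra k B]
    (hB : IsLocallyEtale k B) (φ : A →ₐ[k] B)
    (hφ : Function.Injective (Points.comap (K := K) φ))
    {ψ : Points k K B → K} (hlc : IsLocallyConstant ψ)
    (hψ : ∀ (g : K ≃ₐ[k] K) f, ψ (g • f) = g (ψ f)) : ∃ a : A, ∀ f, f.eval (φ a) = ψ f := by
  have := Points.compactSpace (K := K) hB
  let ev : A →ₐ[k] (Points k K B → K) := AlgHom.pi fun f => f.toAlgHom.comp φ
  have hev (a : A) (f : Points k K B) : ev a f = f.eval (φ a) := rfl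
  obtain ⟨a, ha⟩ : ψ ∈ ev.range := by
    refine mem_of_separates_of_equivariant ev.range ?_ ?_ ?_ hlc hψ
    · rintro _ ⟨a, rfl⟩
      exact Points.isLocallyConstant_eval (φ a)
    · rintro _ ⟨a, rfl⟩ g f
      rfl
    · intro f f' hne
      by_contra! hcon
      exact hne (hφ (Points.ext fun a => hcon _ ⟨a, rfl⟩))
  exact ⟨a, fun f => congrFun ha f⟩

/-- Galois descent: a locally étale algebra is the algebra of equivariant functions on its
points. -/
theorem exists_eval_eq [IsSepClosure k K] (hA : IsLocallyEtale k A)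
    {ψ : Points k K A → K} (hlc : IsLocallyConstant ψ)
    (hψ : ∀ (g : K ≃ₐ[k] K) f, ψ (g • f) = g (ψ f)) : ∃ a : A, ∀ f, f.eval a = ψ f :=
  exists_eval_comp_eq hA (AlgHom.id k A) (fun _ _ h => h) hlc hψ

end Evaluation

/-! ### The anti-equivalence -/

section Equivalence

variable {k K : Type u} [Field k] [Field K] [Algebra k K] [IsSepClosure k K]
  {σ : k →+* k} {τ : K →+* K} (hτ : ∀ c, τ (algebraMap k K c) = algebraMap k K (σ c))

/-- The difference algebra of locally constant equivariant functions on `X`, with the endomorphism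
`φ ↦ τ ∘ φ ∘ σ_X`. -/
def functionAlg (X : DiffProfAction (galSigma hτ)) : DiffLocEtaleAlg σ where
  obj :=
    { carrier := equivariantFunctions k K X.carrier
      sigma :=
        { toFun := fun φ => ⟨fun x => τ (φ.1 (X.sigma x)),
            (φ.2.1.comp_continuous X.continuous_sigma).comp τ, fun g x => by
              change τ (φ.1 (X.sigma (g • x))) = g (τ (φ.1 (X.sigma x)))
              rw [X.sigma_smul, φ.2.2, galSigma_spec]⟩
          map_one' := Subtype.ext (funext fun _ => map_one τ)
          map_mul' := fun _ _ => Subtype.ext (funext fun _ => map_mul τ _ _)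
          map_zero' := Subtype.ext (funext fun _ => map_zero τ)
          map_add' := fun _ _ => Subtype.ext (funext fun _ => map_add τ _ _) }
      sigma_algebraMap := fun c => Subtype.ext (funext fun _ => hτ c) }
  property := isLocallyEtale_equivariantFunctions

/-- Evaluation at the points of `X`. -/
def evalHom (X : DiffProfAction (galSigma hτ)) : X ⟶ pointsObj hτ (functionAlg hτ X) where
  toFun x := ⟨(Pi.evalAlgHom k (fun _ => K) x).comp (equivariantFunctions k K X.carrier).val⟩
  continuous_toFun := Points.continuous_of fun φ c => φ.2.1.isOpen_fiber c
  map_smul g x := Points.ext fun φ => φ.2.2 g x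
  map_sigma _ := Points.conj_unique hτ _ (functionAlg hτ X).obj.sigma_algebraMap
    (functionAlg hτ X).property _ _ fun _ => rfl

/-- Every point of the function algebra of `X` is the evaluation at a point of `X`: a function that
vanishes on the compact image of `X` is zero, so no point lies outside this image. -/
lemma evalHom_bijective (X : DiffProfAction (galSigma hτ)) :
    Function.Bijective (evalHom hτ X).toFun := by
  have heval (x : X.carrier) (φ : equivariantFunctions k K X.carrier) :
      Points.eval ((evalHom hτ X).toFun x) φ = φ.1 x := rfl
  constructor
  · intro x y hxy
    by_contra hne
    obtain ⟨φ, hφ, h⟩ := exists_equivariant_ne (k := k) (K := K) hne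
    exact h (((heval x ⟨φ, hφ⟩).symm.trans (by rw [hxy])).trans (heval y ⟨φ, hφ⟩))
  · intro f
    by_contra hf
    obtain ⟨φ, hφ, h⟩ := Points.exists_eval_ne_zero_of_notMem
      (Z := Set.range (evalHom hτ X).toFun)
      (isCompact_range (evalHom hτ X).continuous_toFun)
      (by rintro g _ ⟨x, rfl⟩; exact ⟨g • x, (evalHom hτ X).map_smul g x⟩) hf
    refine h ?_
    have : φ = 0 := Subtype.ext (funext fun x => hφ _ ⟨x, rfl⟩)
    rw [this]
    exact map_zero f.toAlgHom

/-- A bijective morphism of compact spaces is an isomorphism. -/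
lemma isIso_of_bijective {G : Type u} [Group G] [TopologicalSpace G] {s : G →ₜ* G}
    {X Y : DiffProfAction s} (f : X ⟶ Y) (hf : Function.Bijective f.toFun) : IsIso f := by
  let e := Equiv.ofBijective f.toFun hf
  have he : Continuous e := f.continuous_toFun
  refine ⟨⟨⟨e.symm, he.continuous_symm_of_equiv_compact_to_t2, fun g y => ?_, fun y => ?_⟩, ?_, ?_⟩⟩
  · exact e.symm_apply_eq.2 ((f.map_smul g _).trans (congrArg _ (e.apply_symm_apply y))).symm
  · exact e.symm_apply_eq.2 ((f.map_sigma _).trans (congrArg _ (e.apply_symm_apply y))).symm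
  · exact DiffProfAction.Hom.ext (funext e.symm_apply_apply)
  · exact DiffProfAction.Hom.ext (funext e.apply_symm_apply)

lemma pointsFunctor_faithful : (pointsFunctor hτ).Faithful where
  map_injective {A B} φ ψ h := by
    have h1 (b : B.unop.obj.carrier) :
        φ.unop.hom.toAlgHom b = ψ.unop.hom.toAlgHom b := by
      refine A.unop.property.eq_of_eval_eq (K := K) fun f => ?_
      exact congrArg (fun h => Points.eval (DiffProfAction.Hom.toFun h f) b) h
    refine Quiver.Hom.unop_inj ?_
    apply InducedCategory.hom_ext
    exact DiffAlg.Hom.ext (AlgHom.ext h1)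

/-- A morphism `X(A) → X(B)` turns elements of `B` into equivariant functions on `X(A)`, that is,
into elements of `A`. -/
lemma pointsFunctor_full : (pointsFunctor hτ).Full where
  map_surjective {A B} h := by
    have hA := A.unop.property
    let h' : Points k K A.unop.obj.carrier → Points k K B.unop.obj.carrier := h.toFun
    have hcont : Continuous h' := h.continuous_toFun
    have hsm (g : K ≃ₐ[k] K) (f) : h' (g • f) = g • h' f := h.map_smul g f
    have hex (b : B.unop.obj.carrier) : ∃ a : A.unop.obj.carrier,
        ∀ f : Points k K A.unop.obj.carrier, f.eval a = (h' f).eval b :=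
      exists_eval_eq hA ((Points.isLocallyConstant_eval b).comp_continuous hcont)
        fun g f => by rw [hsm, Points.eval_smul]
    choose F hF using hex
    let φ : B.unop.obj.carrier →ₐ[k] A.unop.obj.carrier :=
      { toFun := F
        map_one' := hA.eq_of_eval_eq (K := K) fun f => by
          rw [hF]; exact (map_one (h' f).toAlgHom).trans (map_one f.toAlgHom).symm
        map_mul' := fun a b => hA.eq_of_eval_eq (K := K) fun f => by
          rw [hF]
          refine (map_mul (h' f).toAlgHom a b).trans (Eq.trans ?_ (map_mul f.toAlgHom _ _).symm)
          exact congrArg₂ (· * ·) (hF a f).symm (hF b f).symm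
        map_zero' := hA.eq_of_eval_eq (K := K) fun f => by
          rw [hF]; exact (map_zero (h' f).toAlgHom).trans (map_zero f.toAlgHom).symm
        map_add' := fun a b => hA.eq_of_eval_eq (K := K) fun f => by
          rw [hF]
          refine (map_add (h' f).toAlgHom a b).trans (Eq.trans ?_ (map_add f.toAlgHom _ _).symm)
          exact congrArg₂ (· + ·) (hF a f).symm (hF b f).symm
        commutes' := fun c => hA.eq_of_eval_eq (K := K) fun f => by
          rw [hF]
          exact ((h' f).toAlgHom.commutes c).trans (f.toAlgHom.commutes c).symm }
    let Φ : B.unop ⟶ A.unop := ObjectProperty.homMk ⟨φ, fun b => by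
      refine hA.eq_of_eval_eq (K := K) fun f => ?_
      let f' := f.conj hτ _ A.unop.obj.sigma_algebraMap hA
      have hf' : h' f' = (h' f).conj hτ _ B.unop.obj.sigma_algebraMap B.unop.property :=
        h.map_sigma f
      change f.eval (F _) = f.eval (A.unop.obj.sigma (F b))
      rw [hF, ← Points.eval_conj hτ _ A.unop.obj.sigma_algebraMap hA,
        ← Points.eval_conj hτ _ B.unop.obj.sigma_algebraMap B.unop.property, hF, hf']⟩
    refine ⟨Φ.op, DiffProfAction.Hom.ext (funext fun f => Points.ext fun b => ?_)⟩
    exact hF b f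

lemma pointsFunctor_essSurj : (pointsFunctor hτ).EssSurj where
  mem_essImage X :=
    have := isIso_of_bijective (evalHom hτ X) (evalHom_bijective hτ X)
    ⟨.op (functionAlg hτ X), ⟨(asIso (evalHom hτ X)).symm⟩⟩

theorem pointsFunctor_isEquivalence : (pointsFunctor hτ).IsEquivalence where
  faithful := pointsFunctor_faithful hτ
  full := pointsFunctor_full hτ
  essSurj := pointsFunctor_essSurj hτ

end Equivalence

/-! ### Surjective and injective algebra maps -/

section SurjectiveInjective

variable {k K A B : Type u} [Field k] [Field K] [Algebra k K] [CommRing A] [Algebra k A]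
  [CommRing B] [Algebra k B]

lemma Points.continuous_comap (φ : A →ₐ[k] B) : Continuous (Points.comap (K := K) φ) :=
  Points.continuous_of fun _ _ => Points.isOpen_eval _ _

variable [IsSepClosure k K]

/-- If points of `B` are determined by their restrictions to `A`, then the image of `A` separates
points, so it contains every equivariant function on the points of `B`. -/
theorem surjective_iff_injective_comap (hB : IsLocallyEtale k B) (φ : A →ₐ[k] B) :
    Function.Surjective φ ↔ Function.Injective (Points.comap (K := K) φ) := by
  constructor
  · intro hφ f f' h
    refine Points.ext fun b => ?_
    obtain ⟨a, rfl⟩ := hφ b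
    exact congrArg (fun f => Points.eval f a) h
  · intro hφ b
    obtain ⟨a, ha⟩ := exists_eval_comp_eq hB φ hφ (Points.isLocallyConstant_eval b)
      (fun _ _ => rfl)
    exact ⟨a, hB.eq_of_eval_eq ha⟩

/-- A point of `A` that does not extend to `B` gives an element of `A` that vanishes on the image of
the points of `B` but not at that point, that is, a nonzero element of the kernel. -/
theorem injective_iff_surjective_comap (hA : IsLocallyEtale k A) (hB : IsLocallyEtale k B)
    (φ : A →ₐ[k] B) :
    Function.Injective φ ↔ Function.Surjective (Points.comap (K := K) φ) := by
  constructor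
  · intro hφ f
    by_contra hf
    have := Points.compactSpace (K := K) hB
    obtain ⟨a, ha, hfa⟩ := Points.exists_eval_ne_zero_of_notMem
      (isCompact_range (Points.continuous_comap (K := K) φ))
      (by rintro g _ ⟨f, rfl⟩; exact ⟨g • f, rfl⟩) hf
    have hφa : φ a = 0 := hB.eq_of_eval_eq (K := K) fun f' =>
      (ha _ ⟨f', rfl⟩).trans (map_zero f'.toAlgHom).symm
    rw [(map_eq_zero_iff φ hφ).1 hφa] at hfa
    exact hfa (map_zero f.toAlgHom)
  · intro hφ a a' h
    refine hA.eq_of_eval_eq (K := K) fun f => ?_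
    obtain ⟨f, rfl⟩ := hφ f
    exact congrArg f.eval h

end SurjectiveInjective

/-! ### Codings of subshifts -/

section Coding

lemma isLocallyConstant_pi {X ι : Type*} {Z : ι → Type*} [TopologicalSpace X] [Finite ι]
    {f : ∀ i, X → Z i} (hf : ∀ i, IsLocallyConstant (f i)) :
    IsLocallyConstant fun x i => f i x := by
  refine IsLocallyConstant.iff_isOpen_fiber.2 fun z => ?_
  have : (fun x i => f i x) ⁻¹' {z} = ⋂ i, {x | f i x = z i} := by
    ext x
    simp [funext_iff]
  rw [this]
  exact isOpen_iInter_of_finite fun i => (hf i).isOpen_fiber (z i)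

/-- On a compact space, a locally constant function factors through finitely many members of any
family of locally constant functions that separates points. -/
lemma exists_finite_factor {X I E : Type*} {Z : I → Type*} [TopologicalSpace X] [CompactSpace X]
    {f : ∀ i, X → Z i} (hf : ∀ i, IsLocallyConstant (f i))
    (hsep : ∀ x x', (∀ i, f i x = f i x') → x = x') {c : X → E} (hc : IsLocallyConstant c) :
    ∃ B : Set I, B.Finite ∧ ∀ x x', (∀ i ∈ B, f i x = f i x') → c x = c x' := by
  have hT : IsCompact {p : X × X | c p.1 ≠ c p.2} := by
    have h1 : IsLocallyConstant fun p : X × X => (c p.1, c p.2) :=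
      (hc.comp_continuous continuous_fst).prodMk (hc.comp_continuous continuous_snd)
    have h2 : IsOpen {p : X × X | c p.1 = c p.2} := h1 {q | q.1 = q.2}
    exact h2.isClosed_compl.isCompact
  obtain ⟨B, hB, h⟩ := hT.induction_on
    (p := fun T => ∃ B : Set I, B.Finite ∧ ∀ p ∈ T, ∃ i ∈ B, f i p.1 ≠ f i p.2)
    ⟨∅, Set.finite_empty, by simp⟩
    (fun T T' hTT' ⟨B, hB, h⟩ => ⟨B, hB, fun p hp => h p (hTT' hp)⟩)
    (by
      rintro T T' ⟨B, hB, h⟩ ⟨B', hB', h'⟩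
      refine ⟨B ∪ B', hB.union hB', fun p hp => ?_⟩
      rcases hp with hp | hp
      · obtain ⟨i, hi, hne⟩ := h p hp
        exact ⟨i, Or.inl hi, hne⟩
      · obtain ⟨i, hi, hne⟩ := h' p hp
        exact ⟨i, Or.inr hi, hne⟩)
    (by
      rintro ⟨x, x'⟩ hne
      obtain ⟨i, hi⟩ : ∃ i, f i x ≠ f i x' := by
        by_contra! hcon
        exact hne (congrArg c (hsep x x' hcon))
      have h1 : IsLocallyConstant fun p : X × X => (f i p.1, f i p.2) :=
        ((hf i).comp_continuous continuous_fst).prodMk ((hf i).comp_continuous continuous_snd)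
      exact ⟨{p | f i p.1 ≠ f i p.2}, mem_nhdsWithin_of_mem_nhds
        ((h1 {q | q.1 ≠ q.2}).mem_nhds hi), {i}, Set.finite_singleton i,
        fun p hp => ⟨i, rfl, hp⟩⟩)
  refine ⟨B, hB, fun x x' hx => ?_⟩
  by_contra hne
  obtain ⟨i, hi, hi'⟩ := h (x, x') hne
  exact hi' (hx i hi)

/-- A self-map is conjugate to a subshift as soon as the itineraries with respect to some locally
constant function determine the points. -/
lemma isSubshift_of_coding {X : Type u} [TopologicalSpace X] [CompactSpace X] {s : X → X}
    (hs : Continuous s) {E : Type*} {c : X → E} (hc : IsLocallyConstant c)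
    (hsep : ∀ x x', (∀ i, c (s^[i] x) = c (s^[i] x')) → x = x') : IsSubshift s := by
  have hfin : Finite (Set.range c) := hc.range_finite
  let ε := Finite.equivFin (Set.range c)
  let c' (x : X) : Fin (Nat.card (Set.range c)) := ε ⟨c x, x, rfl⟩
  have hc'c {x x' : X} (h : c' x = c' x') : c x = c x' := congrArg Subtype.val (ε.injective h)
  have hc' : IsLocallyConstant c' := IsLocallyConstant.desc (g := fun e => ((ε.symm e : _) : E))
    c' (by
      have : (fun e => ((ε.symm e : _) : E)) ∘ c' = c := funext fun x =>
        congrArg Subtype.val (ε.symm_apply_apply _)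
      rwa [this]) (Subtype.val_injective.comp ε.symm.injective)
  let F (x : X) (i : ℕ) := c' (s^[i] x)
  have hF : Continuous F := continuous_pi fun i =>
    (hc'.comp_continuous (hs.iterate i)).continuous
  have hshift (x : X) : F (s x) = shift (F x) := rfl
  have hinj : Function.Injective F := fun x x' h => hsep x x' fun i => hc'c (congrFun h i)
  let e : X ≃ Set.range F := Equiv.ofInjective F hinj
  have he : Continuous e := hF.subtype_mk _
  refine ⟨Fin (Nat.card (Set.range c)), inferInstance, inferInstance, inferInstance, Set.range F,
    (isCompact_range hF).isClosed, ?_, he.homeoOfEquivCompactToT2, fun x => rfl⟩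
  rintro _ ⟨x, rfl⟩
  exact ⟨s x, rfl⟩

/-- The first letter is locally constant, and its itineraries are the sequences themselves. -/
lemma IsIsoToShiftSubset.exists_coding {X : Type u} [TopologicalSpace X] {s : X → X} {E : Type}
    [TopologicalSpace E] [DiscreteTopology E] {S : Set (ℕ → E)} {e : X ≃ₜ S}
    (he : ∀ x, (e (s x) : ℕ → E) = shift (e x : ℕ → E)) :
    IsLocallyConstant (fun x => (e x : ℕ → E) 0) ∧
      ∀ x i, (e (s^[i] x) : ℕ → E) 0 = (e x : ℕ → E) i := by
  refine ⟨(IsLocallyConstant.iff_continuous _).2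
    ((continuous_apply 0).comp (continuous_subtype_val.comp e.continuous)), fun x i => ?_⟩
  have key (i j : ℕ) : (e (s^[i] x) : ℕ → E) j = (e x : ℕ → E) (i + j) := by
    induction i generalizing j with
    | zero => simp
    | succ i ih =>
      rw [Function.iterate_succ_apply', he, shift, ih, add_right_comm, add_assoc]
  exact key i 0

end Coding

/-! ### Finite generation and subshifts -/

section FinitelyGenerated

variable {k K A : Type u} [Field k] [Field K] [Algebra k K] [IsSepClosure k K] [CommRing A]
  [Algebra k A] {σ : k →+* k} {τ : K →+* K}
  (hτ : ∀ c, τ (algebraMap k K c) = algebraMap k K (σ c))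
  (s : A →+* A) (hs : ∀ c, s (algebraMap k A c) = algebraMap k A (σ c)) (hA : IsLocallyEtale k A)

/-- The iterated form of the equation that determines `f^σ`. -/
lemma Points.eval_iterate_conj (f : Points k K A) (a : A) (j : ℕ) :
    τ^[j] (((Points.conj hτ s hs hA)^[j] f).eval a) = f.eval (s^[j] a) := by
  induction j generalizing f with
  | zero => rfl
  | succ j ih =>
    rw [Function.iterate_succ_apply', Function.iterate_succ_apply, ih, Points.eval_conj,
      Function.iterate_succ_apply']

/-- `σ`-generators determine points through their itineraries. -/
lemma Points.eq_of_eval_iterate_conj {B : Set A}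
    (hB : Algebra.adjoin k {a | ∃ b ∈ B, ∃ j : ℕ, a = s^[j] b} = ⊤) {f f' : Points k K A}
    (h : ∀ i, ∀ b ∈ B, ((Points.conj hτ s hs hA)^[i] f).eval b =
      ((Points.conj hτ s hs hA)^[i] f').eval b) : f = f' := by
  have : f.toAlgHom = f'.toAlgHom := by
    refine AlgHom.ext_of_adjoin_eq_top hB ?_
    rintro _ ⟨b, hb, j, rfl⟩
    change f.eval _ = f'.eval _
    rw [← Points.eval_iterate_conj hτ s hs hA, ← Points.eval_iterate_conj hτ s hs hA, h j b hb]
  exact Points.ext fun a => congrArg (fun f => f a) this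

/-- If the points of `A` form a subshift, finitely many elements of `A` determine the first
letter, hence their `σ`-iterates separate points and generate `A`. -/
theorem finite_generators_iff_isSubshift :
    (∃ B : Set A, B.Finite ∧ Algebra.adjoin k {a | ∃ b ∈ B, ∃ j : ℕ, a = s^[j] b} = ⊤) ↔
      IsSubshift (Points.conj hτ s hs hA) := by
  have := Points.compactSpace (K := K) hA
  constructor
  · rintro ⟨B, hBfin, hB⟩
    have : Finite B := hBfin
    refine isSubshift_of_coding (Points.continuous_conj hτ s hs hA)
      (c := fun f (b : B) => f.eval (b : A))
      (isLocallyConstant_pi fun b => Points.isLocallyConstant_eval _) fun f f' h => ?_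
    exact Points.eq_of_eval_iterate_conj hτ s hs hA hB fun i b hb => congrFun (h i) ⟨b, hb⟩
  · rintro ⟨E, _, _, _, S, -, -, e, he⟩
    obtain ⟨hlc, hit⟩ := IsIsoToShiftSubset.exists_coding he
    obtain ⟨B, hBfin, hB⟩ := exists_finite_factor
      (f := fun (a : A) (f : Points k K A) => f.eval a) (fun a => Points.isLocallyConstant_eval a)
      (fun f f' h => Points.ext h) hlc
    refine ⟨B, hBfin, ?_⟩
    let D := Algebra.adjoin k {a | ∃ b ∈ B, ∃ j : ℕ, a = s^[j] b}
    have hsurj : Function.Surjective D.val := by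
      refine (surjective_iff_injective_comap (K := K) hA D.val).2 fun f f' h => ?_
      refine e.injective (Subtype.ext (funext fun i => ?_))
      rw [← hit f i, ← hit f' i]
      refine hB _ _ fun b hb => (τ.injective.iterate i) ?_
      rw [Points.eval_iterate_conj hτ s hs hA, Points.eval_iterate_conj hτ s hs hA]
      exact congrArg (fun f => Points.eval f
        (⟨s^[i] b, Algebra.subset_adjoin ⟨b, hb, i, rfl⟩⟩ : D)) h
    exact Algebra.eq_top_iff.2 fun a => by
      obtain ⟨d, rfl⟩ := hsurj a
      exact d.2

end FinitelyGenerated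

/-! ### Subshifts of finite type -/

section FiniteType

/-- Higher block coding. If the itineraries of the points of `X` are exactly the sequences all of
whose shifts lie in a clopen set `W`, then `X` is a subshift of finite type: `W` is determined by
the first `N` letters, and `X` is the path space of the graph whose vertices are the words of
length `N` and whose edges are the words of length `N + 1` that begin with an admissible word. -/
theorem isSubshiftOfFiniteType_of_isClopen {X : Type u} [TopologicalSpace X] [CompactSpace X]
    {s : X → X} (hs : Continuous s) {E : Type} [Finite E] [TopologicalSpace E]
    [DiscreteTopology E] {c : X → E} (hc : IsLocallyConstant c)
    (hsep : ∀ x x', (∀ i, c (s^[i] x) = c (s^[i] x')) → x = x') {W : Set (ℕ → E)}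
    (hW : IsClopen W) (hXW : ∀ x, (fun i => c (s^[i] x)) ∈ W)
    (hWX : ∀ y : ℕ → E, (∀ j, (fun i => y (i + j)) ∈ W) → ∃ x, ∀ i, c (s^[i] x) = y i) :
    IsSubshiftOfFiniteType s := by
  -- Membership in the clopen set `W` depends on finitely many letters.
  obtain ⟨N, hN⟩ : ∃ N, ∀ y y' : ℕ → E, (∀ i < N, y i = y' i) → (y ∈ W ↔ y' ∈ W) := by
    have hlc : IsLocallyConstant fun y : ℕ → E => y ∈ W := by
      refine IsLocallyConstant.iff_isOpen_fiber.2 fun q => ?_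
      by_cases hq : q
      · convert! hW.isOpen using 1
        ext y
        simp [hq]
      · convert! hW.compl.isOpen using 1
        ext y
        simp [hq]
    obtain ⟨B, hB, h⟩ := exists_finite_factor (f := fun (i : ℕ) (y : ℕ → E) => y i)
      (fun i => (IsLocallyConstant.iff_continuous _).2 (continuous_apply i))
      (fun y y' h => funext h) hlc
    obtain ⟨M, hM⟩ := hB.bddAbove
    exact ⟨M + 1, fun y y' hy => iff_of_eq (h y y' fun i hi => hy i (Nat.lt_succ_of_le (hM hi)))⟩
  let P (u : Fin N → E) : Prop := ∃ y ∈ W, ∀ i : Fin N, y i = u i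
  let Edge := {w : Fin (N + 1) → E // P fun i => w i.castSucc}
  let src (w : Edge) (i : Fin N) : E := w.1 i.castSucc
  let tgt (w : Edge) (i : Fin N) : E := w.1 i.succ
  let _ : TopologicalSpace Edge := ⊥
  have : DiscreteTopology Edge := ⟨rfl⟩
  let F (x : X) (i : ℕ) : Edge := ⟨fun j => c (s^[i + j] x), fun j => c (s^[j] (s^[i] x)),
    hXW _, fun j => by
      change c (s^[j] (s^[i] x)) = c (s^[i + j] x)
      rw [← Function.iterate_add_apply, add_comm]⟩
  have hF : Continuous F := by
    refine continuous_pi fun i => IsLocallyConstant.continuous ?_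
    refine IsLocallyConstant.desc (g := Subtype.val) _ ?_ Subtype.val_injective
    exact isLocallyConstant_pi fun j => hc.comp_continuous (hs.iterate (i + j))
  have hFp (x : X) : F x ∈ pathSpace src tgt := fun i => funext fun j => by
    change c (s^[i + 1 + j] x) = c (s^[i + (j + 1)] x)
    rw [add_assoc, add_comm 1]
  have hinj {x x' : X} (h : F x = F x') : x = x' := hsep x x' fun i =>
    congrFun (congrArg Subtype.val (congrFun h i)) 0
  have hsurj (w : ℕ → Edge) (hw : w ∈ pathSpace src tgt) : ∃ x, F x = w := by
    have hword (j : ℕ) (hj : j < N + 1) (i : ℕ) : (w i).1 ⟨j, hj⟩ = (w (i + j)).1 0 := by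
      induction j generalizing i with
      | zero => rfl
      | succ j ih =>
        have h1 : (w (i + 1)).1 ⟨j, (Nat.lt_succ_self j).trans hj⟩ = (w i).1 ⟨j + 1, hj⟩ :=
          congrFun (hw i) ⟨j, Nat.lt_of_succ_lt_succ hj⟩
        rw [← h1, ih, add_assoc, add_comm 1]
    obtain ⟨x, hx⟩ := hWX (fun i => (w i).1 0) fun j => by
      obtain ⟨y, hy, hyw⟩ := (w j).2
      refine (hN _ y fun i hi => ?_).2 hy
      rw [hyw ⟨i, hi⟩, add_comm i j]
      exact (hword i (hi.trans (Nat.lt_succ_self N)) j).symm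
    refine ⟨x, funext fun i => Subtype.ext (funext fun j => ?_)⟩
    exact (hx _).trans (hword j j.2 i).symm
  let e : X ≃ pathSpace src tgt := Equiv.ofBijective (fun x => ⟨F x, hFp x⟩)
    ⟨fun x x' h => hinj (congrArg Subtype.val h),
      fun w => (hsurj w.1 w.2).imp fun x hx => Subtype.ext hx⟩
  have he : Continuous e := hF.subtype_mk _
  refine ⟨Fin N → E, Edge, inferInstance, inferInstance, inferInstance, inferInstance, src, tgt,
    he.homeoOfEquivCompactToT2, fun x => funext fun i => Subtype.ext (funext fun j => ?_)⟩
  change c (s^[i + j] (s x)) = c (s^[i + 1 + j] x)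
  rw [← Function.iterate_succ_apply, add_right_comm]

/-- A locally constant function on a compact space extends along an injection into a space whose
points are separated by locally constant functions. -/
lemma exists_isLocallyConstant_extension {X Y I E : Type*} {Z : I → Type*} [TopologicalSpace X]
    [CompactSpace X] [TopologicalSpace Y] [Nonempty E] {ι : X → Y} (hι : Continuous ι)
    (hinj : Function.Injective ι) {f : ∀ i, Y → Z i} (hf : ∀ i, IsLocallyConstant (f i))
    (hsep : ∀ y y', (∀ i, f i y = f i y') → y = y') {c : X → E} (hc : IsLocallyConstant c) :
    ∃ c' : Y → E, IsLocallyConstant c' ∧ ∀ x, c' (ι x) = c x := by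
  obtain ⟨B, hB, h⟩ := exists_finite_factor (f := fun i x => f i (ι x))
    (fun i => (hf i).comp_continuous hι) (fun x x' h => hinj (hsep _ _ h)) hc
  have : Finite B := hB
  let R (y : Y) (i : B) : Z i := f i y
  have hR : IsLocallyConstant R := isLocallyConstant_pi fun i => hf i
  have hfac : Function.FactorsThrough c (R ∘ ι) := fun x x' hx =>
    h x x' fun i hi => congrFun hx ⟨i, hi⟩
  exact ⟨Function.extend (R ∘ ι) c (fun _ => Classical.arbitrary E) ∘ R, hR.comp _,
    fun x => hfac.extend_apply _ x⟩

/-- Subshifts of finite type are isolated from the outside: if `X` is one and sits in an expansive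
system `Y`, then every stable subset of `Y` close to `X` is contained in `X`. The first letter of
the points of `X` extends to `Y`. Near `X` the resulting itineraries are paths of the graph, and the
points of `X` that they define have the same itineraries in `Y`, by the second condition on the
neighbourhood. -/
theorem exists_isOpen_isolating {X : Type u} {Y D : Type*} [TopologicalSpace X] [CompactSpace X]
    [TopologicalSpace Y] {s : X → X} {t : Y → Y} (ht : Continuous t) {ι : X → Y}
    (hι : Continuous ι) (hinj : Function.Injective ι) (hst : ∀ x, ι (s x) = t (ι x))
    (hX : IsSubshiftOfFiniteType s) {d : Y → D} (hd : IsLocallyConstant d)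
    (hsep : ∀ y y', (∀ i, d (t^[i] y) = d (t^[i] y')) → y = y') :
    ∃ U, IsOpen U ∧ Set.range ι ⊆ U ∧
      ∀ V, V ⊆ U → Set.MapsTo t V V → V ⊆ Set.range ι := by
  rcases isEmpty_or_nonempty X with hemp | ⟨⟨x₀⟩⟩
  · exact ⟨∅, isOpen_empty, by rintro _ ⟨x, -⟩; exact hemp.elim x,
      fun V hV _ => hV.trans (Set.empty_subset _)⟩
  obtain ⟨V, E, _, _, _, _, src, tgt, e, he⟩ := hX
  obtain ⟨hlc, hit⟩ := IsIsoToShiftSubset.exists_coding he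
  have : Nonempty E := ⟨(e x₀ : ℕ → E) 0⟩
  have : Nonempty D := ⟨d (ι x₀)⟩
  obtain ⟨c, hc, hcι⟩ := exists_isLocallyConstant_extension hι hinj
    (fun i => hd.comp_continuous (ht.iterate i)) hsep hlc
  let w (y : Y) (i : ℕ) : E := c (t^[i] y)
  have hw : Continuous w := continuous_pi fun i =>
    (hc.comp_continuous (ht.iterate i)).continuous
  have hιi (i : ℕ) (x : X) : ι (s^[i] x) = t^[i] (ι x) := Function.Semiconj.iterate_right hst i x
  have hwι (x : X) : w (ι x) = e x := funext fun i => by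
    change c (t^[i] (ι x)) = _
    rw [← hιi, hcι, hit]
  obtain ⟨δ, hδ, hδe⟩ := exists_isLocallyConstant_extension (ι := fun x => (e x : ℕ → E))
    (continuous_subtype_val.comp e.continuous) (Subtype.val_injective.comp e.injective)
    (f := fun (i : ℕ) (z : ℕ → E) => z i)
    (fun i => (IsLocallyConstant.iff_continuous _).2 (continuous_apply i))
    (fun z z' h => funext h) (hd.comp_continuous hι)
  refine ⟨{y | src (c (t y)) = tgt (c y)} ∩ {y | δ (w y) = d y}, ?_, ?_, ?_⟩
  · refine IsOpen.inter ?_ ?_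
    · exact ((hc.comp_continuous ht).prodMk hc) {q | src q.1 = tgt q.2}
    · exact ((hδ.comp_continuous hw).prodMk hd) {q | q.1 = q.2}
  · rintro _ ⟨x, rfl⟩
    refine ⟨?_, ?_⟩
    · have := (e x).2 0
      rw [← hwι x] at this
      exact this
    · change δ (w (ι x)) = d (ι x)
      rw [hwι, hδe]
      rfl
  · intro V hVU hV y hy
    have hyi (i : ℕ) : t^[i] y ∈ V := (hV.iterate i) hy
    have hpath : w y ∈ pathSpace src tgt := fun i => by
      have := (hVU (hyi i)).1
      change src (c (t^[i + 1] y)) = tgt (c (t^[i] y))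
      rw [Function.iterate_succ_apply']
      exact this
    obtain ⟨x, hx⟩ := e.surjective ⟨w y, hpath⟩
    have hwx : w (ι x) = w y := by rw [hwι, hx]
    have hwi (i : ℕ) : w (t^[i] (ι x)) = w (t^[i] y) := funext fun j => by
      change c (t^[j] (t^[i] (ι x))) = c (t^[j] (t^[i] y))
      rw [← Function.iterate_add_apply, ← Function.iterate_add_apply]
      exact congrFun hwx (j + i)
    refine ⟨x, hsep _ _ fun i => ?_⟩
    have h1 : δ (w (t^[i] y)) = d (t^[i] y) := (hVU (hyi i)).2
    rw [← h1, ← hwi, ← hιi, hwι, hδe]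
    rfl

end FiniteType

/-! ### Difference ideals -/

section SigmaIdeal

/-- The ideal generated by `B, s(B), s²(B), …`. -/
def sigmaSpan {R : Type*} [CommRing R] (s : R →+* R) (B : Set R) : Ideal R :=
  Ideal.span {q | ∃ b ∈ B, ∃ j : ℕ, q = s^[j] b}

variable {R S : Type*} [CommRing R] [CommRing S] {s : R →+* R} {s' : S →+* S}

lemma iterate_mem_sigmaSpan {B : Set R} {b : R} (hb : b ∈ B) (j : ℕ) :
    s^[j] b ∈ sigmaSpan s B := Ideal.subset_span ⟨b, hb, j, rfl⟩

lemma sigmaSpan_mono {B C : Set R} (h : B ⊆ C) : sigmaSpan s B ≤ sigmaSpan s C :=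
  Ideal.span_mono fun _ ⟨b, hb, j, hj⟩ => ⟨b, h hb, j, hj⟩

lemma sigmaSpan_le_comap (s : R →+* R) (B : Set R) :
    sigmaSpan s B ≤ (sigmaSpan s B).comap s := by
  refine Ideal.span_le.2 ?_
  rintro _ ⟨b, hb, j, rfl⟩
  change s (s^[j] b) ∈ sigmaSpan s B
  rw [← Function.iterate_succ_apply' s]
  exact iterate_mem_sigmaSpan hb (j + 1)

lemma sigmaSpan_le_ker {B : Set R} {π : R →+* S} (hπ : ∀ p, π (s p) = s' (π p))
    (hB : ∀ b ∈ B, π b = 0) : sigmaSpan s B ≤ RingHom.ker π := by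
  refine Ideal.span_le.2 ?_
  rintro _ ⟨b, hb, j, rfl⟩
  have h1 : π (s^[j] b) = s'^[j] (π b) := Function.Semiconj.iterate_right hπ j b
  have h2 : s'^[j] 0 = 0 := Function.iterate_fixed (map_zero s') j
  exact (RingHom.mem_ker).2 (by rw [h1, hB b hb, h2])

lemma map_sigmaSpan {B : Set R} {π : R →+* S} (hπ : ∀ p, π (s p) = s' (π p)) :
    (sigmaSpan s B).map π = sigmaSpan s' (π '' B) := by
  have h1 (j : ℕ) (b : R) : π (s^[j] b) = s'^[j] (π b) := Function.Semiconj.iterate_right hπ j b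
  rw [sigmaSpan, Ideal.map_span, sigmaSpan]
  congr 1
  ext q
  constructor
  · rintro ⟨_, ⟨b, hb, j, rfl⟩, rfl⟩
    exact ⟨π b, ⟨b, hb, rfl⟩, j, h1 j b⟩
  · rintro ⟨_, ⟨b, hb, rfl⟩, j, rfl⟩
    exact ⟨_, ⟨b, hb, j, rfl⟩, h1 j b⟩

end SigmaIdeal

/-! ### Difference polynomials -/

section DifferencePolynomials

variable {k : Type u} [Field k] {σ : k →+* k}

lemma DiffPoly.iterate_sigma_X {n : ℕ} (i : Fin n) (l : ℕ) :
    (DiffPoly.sigma σ n)^[l] (MvPolynomial.X (i, 0)) = MvPolynomial.X (i, l) := by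
  induction l with
  | zero => rfl
  | succ l ih =>
    rw [Function.iterate_succ_apply', ih]
    exact MvPolynomial.eval₂Hom_X' _ _ _

lemma DiffPoly.sigma_C {n : ℕ} (c : k) :
    DiffPoly.sigma σ n (MvPolynomial.C c) = MvPolynomial.C (σ c) :=
  MvPolynomial.eval₂Hom_C _ _ _

lemma DiffPoly.sigma_aeval {n : ℕ} (z : DiffPoly k n) (q : Polynomial k) :
    DiffPoly.sigma σ n (Polynomial.aeval z q) =
      Polynomial.aeval (DiffPoly.sigma σ n z) (q.map σ) := by
  rw [Polynomial.aeval_def, Polynomial.hom_eval₂, Polynomial.aeval_def, Polynomial.eval₂_map]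
  congr 1
  exact RingHom.ext fun c => DiffPoly.sigma_C c

/-- Every `σ^l(xᵢ)` is annihilated by a separable polynomial modulo the `σ`-ideal generated by a
separable polynomial in `xᵢ`. -/
lemma DiffPoly.exists_separable_aeval_X {n : ℕ} {p : Polynomial k} (hp : p.Separable) (i : Fin n)
    (l : ℕ) : ∃ q : Polynomial k, q.Separable ∧
      Polynomial.aeval (MvPolynomial.X (i, l) : DiffPoly k n) q =
        (DiffPoly.sigma σ n)^[l] (Polynomial.aeval (MvPolynomial.X (i, 0)) p) := by
  induction l with
  | zero => exact ⟨p, hp, rfl⟩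
  | succ l ih =>
    obtain ⟨q, hq, h⟩ := ih
    refine ⟨q.map σ, hq.map, ?_⟩
    rw [Function.iterate_succ_apply', ← h, DiffPoly.sigma_aeval, ← DiffPoly.iterate_sigma_X i l,
      ← Function.iterate_succ_apply' (DiffPoly.sigma σ n), DiffPoly.iterate_sigma_X]

/-- The substitution `σ^l(xᵢ) ↦ τ^l(v_l(i))` turns the endomorphism of the difference polynomial
ring into the shift of `v`, up to `τ`. -/
lemma DiffPoly.aeval_iterate_sigma {K : Type u} [Field K] [Algebra k K] {τ : K →+* K}
    (hτ : ∀ c, τ (algebraMap k K c) = algebraMap k K (σ c)) {n : ℕ} (v : ℕ → Fin n → K) (j : ℕ)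
    (q : DiffPoly k n) :
    MvPolynomial.aeval (fun p : Fin n × ℕ => τ^[p.2] (v p.2 p.1)) ((DiffPoly.sigma σ n)^[j] q) =
      τ^[j] (MvPolynomial.aeval (fun p : Fin n × ℕ => τ^[p.2] (v (p.2 + j) p.1)) q) := by
  induction j generalizing v with
  | zero => rfl
  | succ j ih =>
    have step (q : DiffPoly k n) : MvPolynomial.aeval (fun p : Fin n × ℕ => τ^[p.2] (v p.2 p.1))
        (DiffPoly.sigma σ n q) =
        τ (MvPolynomial.aeval (fun p : Fin n × ℕ => τ^[p.2] (v (p.2 + 1) p.1)) q) := by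
      induction q using MvPolynomial.induction_on with
      | C c => rw [DiffPoly.sigma_C, MvPolynomial.aeval_C, MvPolynomial.aeval_C, hτ]
      | add p q hp hq => simp only [map_add, hp, hq]
      | mul_X p x hp =>
        have hX : DiffPoly.sigma σ n (MvPolynomial.X x) = MvPolynomial.X (x.1, x.2 + 1) :=
          MvPolynomial.eval₂Hom_X' _ _ _
        rw [map_mul, map_mul, hp, hX, map_mul, map_mul, MvPolynomial.aeval_X,
          MvPolynomial.aeval_X, ← Function.iterate_succ_apply' τ]
    rw [Function.iterate_succ_apply', step, ih (fun l => v (l + 1)),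
      ← Function.iterate_succ_apply' τ]
    simp only [add_assoc]

end DifferencePolynomials

/-! ### Finite presentation and subshifts of finite type -/

section FinitelyPresented

variable {k K A : Type u} [Field k] [Field K] [Algebra k K] [IsSepClosure k K] [CommRing A]
  [Algebra k A] {σ : k →+* k} {τ : K →+* K}
  (hτ : ∀ c, τ (algebraMap k K c) = algebraMap k K (σ c))
  (s : A →+* A) (hs : ∀ c, s (algebraMap k A c) = algebraMap k A (σ c)) (hA : IsLocallyEtale k A)

/-- The points of a finitely `σ`-presented algebra are the sequences of values of the generators,
taken among the finitely many roots of separable polynomials, that satisfy the relations and all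
their shifts. The relations define a clopen condition. -/
theorem isSubshiftOfFiniteType_of_presentation {n : ℕ} (π : DiffPoly k n →ₐ[k] A)
    (hsurj : Function.Surjective π) (hπ : ∀ p, π (DiffPoly.sigma σ n p) = s (π p))
    {B : Set (DiffPoly k n)} (hB : B.Finite)
    (hker : RingHom.ker π = sigmaSpan (DiffPoly.sigma σ n) B) :
    IsSubshiftOfFiniteType (Points.conj hτ s hs hA) := by
  have := Points.compactSpace (K := K) hA
  choose p hps hp using fun i : Fin n => hA (π (MvPolynomial.X (i, 0)))
  let R : Set (Fin n → K) := {v | ∀ i, Polynomial.aeval (v i) (p i) = 0}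
  have hR : R.Finite := by
    refine Set.Finite.pi' (t := fun i => {c : K | Polynomial.aeval c (p i) = 0}) fun i => ?_
    have hne : (p i).map (algebraMap k K) ≠ 0 :=
      (Polynomial.map_ne_zero_iff (algebraMap k K).injective).2 (hps i).ne_zero
    refine (Polynomial.finite_setOfPred_isRoot hne).subset fun c hc => ?_
    simpa [Polynomial.IsRoot, Polynomial.aeval_def, Polynomial.eval_map] using hc
  have : Finite R := hR
  let ε := Finite.equivFin R
  let x (f : Points k K A) : R := ⟨fun i => f.eval (π (MvPolynomial.X (i, 0))),
    fun i => f.eval_isRoot (hp i)⟩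
  have hx : IsLocallyConstant x := IsLocallyConstant.desc (g := Subtype.val) _
    (isLocallyConstant_pi fun i => Points.isLocallyConstant_eval _) Subtype.val_injective
  let c (f : Points k K A) : Fin (Nat.card R) := ε (x f)
  have hc : IsLocallyConstant c := hx.comp ε
  let val (y : ℕ → Fin (Nat.card R)) (l : ℕ) : Fin n → K := (ε.symm (y l)).1
  let H (v : ℕ → Fin n → K) : DiffPoly k n →ₐ[k] K :=
    MvPolynomial.aeval fun p : Fin n × ℕ => τ^[p.2] (v p.2 p.1)
  let conj := Points.conj (K := K) hτ s hs hA
  have hπi (j : ℕ) (q : DiffPoly k n) : π ((DiffPoly.sigma σ n)^[j] q) = s^[j] (π q) :=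
    Function.Semiconj.iterate_right hπ j q
  have hval (f : Points k K A) (l : ℕ) : val (fun i => c (conj^[i] f)) l = (x (conj^[l] f)).1 :=
    congrArg Subtype.val (ε.symm_apply_apply _)
  have hcomp (f : Points k K A) (q : DiffPoly k n) :
      f.eval (π q) = H (val fun i => c (conj^[i] f)) q := by
    have : f.toAlgHom.comp π = H (val fun i => c (conj^[i] f)) := by
      refine MvPolynomial.algHom_ext fun ⟨i, l⟩ => ?_
      rw [MvPolynomial.aeval_X, hval, ← DiffPoly.iterate_sigma_X (σ := σ)]
      change f.eval (π _) = _
      rw [hπi, ← Points.eval_iterate_conj hτ s hs hA]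
    exact congrArg (fun φ => φ q) this
  have hHi (y : ℕ → Fin (Nat.card R)) (j : ℕ) (q : DiffPoly k n) :
      H (val y) ((DiffPoly.sigma σ n)^[j] q) = τ^[j] (H (val fun i => y (i + j)) q) :=
    DiffPoly.aeval_iterate_sigma hτ (val y) j q
  let W : Set (ℕ → Fin (Nat.card R)) := {y | ∀ b ∈ B, H (val y) b = 0}
  have hHlc (q : DiffPoly k n) : IsLocallyConstant fun y => H (val y) q := by
    induction q using MvPolynomial.induction_on with
    | C r =>
      simp only [H, MvPolynomial.aeval_C]
      exact IsLocallyConstant.const _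
    | add p q hp hq =>
      simp only [map_add]
      exact hp.comp₂ hq (· + ·)
    | mul_X p x hp =>
      simp only [map_mul]
      refine hp.comp₂ ?_ (· * ·)
      simp only [H, MvPolynomial.aeval_X]
      have h : IsLocallyConstant fun y : ℕ → Fin (Nat.card R) => y x.2 :=
        (IsLocallyConstant.iff_continuous _).2 (continuous_apply x.2)
      exact h.comp fun e => τ^[x.2] ((ε.symm e).1 x.1)
  have hsep (f f' : Points k K A) (h : ∀ i, c (conj^[i] f) = c (conj^[i] f')) : f = f' := by
    refine Points.ext fun a => ?_
    obtain ⟨q, rfl⟩ := hsurj a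
    rw [hcomp, hcomp, funext h]
  refine isSubshiftOfFiniteType_of_isClopen (Points.continuous_conj hτ s hs hA) hc hsep (W := W)
    ?_ (fun f b hb => ?_) fun y hy => ?_
  · have : W = ⋂ b ∈ B, {y | H (val y) b = 0} := by
      ext y
      simp only [W, Set.mem_iInter, Set.mem_ofPred_eq]
    rw [this]
    exact hB.isClopen_biInter fun b _ => (hHlc b).isClopen_fiber 0
  · have hb0 : π b = 0 := by
      rw [← RingHom.mem_ker, hker]
      exact iterate_mem_sigmaSpan hb 0
    refine (hcomp f b).symm.trans ?_
    rw [hb0]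
    exact map_zero f.toAlgHom
  · have hle : RingHom.ker π.toRingHom ≤ RingHom.ker (H (val y)).toRingHom := by
      refine hker.le.trans (Ideal.span_le.2 ?_)
      rintro _ ⟨b, hb, j, rfl⟩
      change H (val y) ((DiffPoly.sigma σ n)^[j] b) = 0
      rw [hHi, hy j b hb]
      exact Function.iterate_fixed (map_zero τ) j
    let f : Points k K A := ⟨AlgHom.liftOfSurjective π hsurj (H (val y)) hle⟩
    have hf (q : DiffPoly k n) : f.eval (π q) = H (val y) q :=
      AlgHom.liftOfSurjective_apply _ _ _ _ q
    refine ⟨f, fun i => ε.symm.injective (Subtype.ext (funext fun i' => ?_))⟩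
    refine (τ.injective.iterate i) ?_
    change τ^[i] ((ε.symm (ε (x (conj^[i] f)))).1 i') = τ^[i] (val y i i')
    rw [ε.symm_apply_apply]
    refine (Points.eval_iterate_conj hτ s hs hA f _ i).trans ?_
    rw [← hπi, hf, DiffPoly.iterate_sigma_X]
    exact MvPolynomial.aeval_X _ _

/-- Let `A` be a quotient of a finitely `σ`-generated difference locally étale algebra `A₀`. If the
points of `A` form a subshift of finite type, then the kernel is finitely generated as a
`σ`-ideal: by compactness, finitely many elements of the kernel cut out a subset of `X(A₀)` so
close to `X(A)` that it is contained in `X(A)`. -/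
theorem exists_finite_ker_eq_sigmaSpan {A₀ : Type u} [CommRing A₀] [Algebra k A₀]
    (s₀ : A₀ →+* A₀) (hs₀ : ∀ c, s₀ (algebraMap k A₀ c) = algebraMap k A₀ (σ c))
    (hA₀ : IsLocallyEtale k A₀) (π : A₀ →ₐ[k] A) (hsurj : Function.Surjective π)
    (hπ : ∀ a, π (s₀ a) = s (π a)) {T : Set A₀} (hTfin : T.Finite)
    (hT : Algebra.adjoin k {a | ∃ b ∈ T, ∃ j : ℕ, a = s₀^[j] b} = ⊤)
    (hX : IsSubshiftOfFiniteType (Points.conj hτ s hs hA)) :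
    ∃ F : Set A₀, F.Finite ∧ RingHom.ker π = sigmaSpan s₀ F := by
  have := Points.compactSpace (K := K) hA
  have := Points.compactSpace (K := K) hA₀
  have : Finite T := hTfin
  obtain ⟨U, hU, hrange, hUV⟩ := exists_isOpen_isolating
    (Points.continuous_conj (K := K) hτ s₀ hs₀ hA₀) (Points.continuous_comap π)
    ((surjective_iff_injective_comap hA π).1 hsurj)
    (fun f => Points.conj_unique hτ s₀ hs₀ hA₀ _ _ fun a => by
      rw [Points.eval_comap, Points.eval_comap, Points.eval_conj, hπ]) hX
    (d := fun f (b : T) => f.eval (b : A₀))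
    (isLocallyConstant_pi fun b => Points.isLocallyConstant_eval _)
    (fun f f' h => Points.eq_of_eval_iterate_conj hτ s₀ hs₀ hA₀ hT
      fun i b hb => congrFun (h i) ⟨b, hb⟩)
  let V (F : Set A₀) : Set (Points k K A₀) := {f | ∀ q ∈ sigmaSpan s₀ F, f.eval q = 0}
  have hVmono {F F' : Set A₀} (h : F ⊆ F') : V F' ⊆ V F :=
    fun f hf q hq => hf q (sigmaSpan_mono h hq)
  -- The points of `A` are the common zeros of the kernel, so the complement of `U` is covered by
  -- the open sets where some element of the kernel does not vanish.
  obtain ⟨F, hF, hFker, hFU⟩ : ∃ F : Set A₀, F.Finite ∧ (∀ a ∈ F, π a = 0) ∧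
      Disjoint (V F) Uᶜ := by
    refine hU.isClosed_compl.isCompact.induction_on
      (p := fun T => ∃ F : Set A₀, F.Finite ∧ (∀ a ∈ F, π a = 0) ∧ Disjoint (V F) T)
      ⟨∅, Set.finite_empty, by simp, Set.disjoint_empty _⟩
      (fun T T' hTT' ⟨F, hF, hk, hd⟩ => ⟨F, hF, hk, hd.mono_right hTT'⟩) ?_ ?_
    · rintro T T' ⟨F, hF, hk, hd⟩ ⟨F', hF', hk', hd'⟩
      refine ⟨F ∪ F', hF.union hF', fun a ha => ha.elim (hk a) (hk' a),
        Set.disjoint_union_right.2 ⟨?_, ?_⟩⟩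
      · exact hd.mono_left (hVmono Set.subset_union_left)
      · exact hd'.mono_left (hVmono Set.subset_union_right)
    · intro f hf
      obtain ⟨a, ha, hfa⟩ : ∃ a, π a = 0 ∧ f.eval a ≠ 0 := by
        by_contra! hcon
        let g : Points k K A :=
          ⟨AlgHom.liftOfSurjective π hsurj f.toAlgHom fun a ha => hcon a ha⟩
        have hg (a : A₀) : g.eval (π a) = f.eval a := AlgHom.liftOfSurjective_apply _ _ _ _ a
        exact hf (hrange ⟨g, Points.ext hg⟩)
      refine ⟨{f' | f'.eval a = f.eval a},
        mem_nhdsWithin_of_mem_nhds ((Points.isOpen_eval a _).mem_nhds rfl), {a},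
        Set.finite_singleton a, by simpa using ha, Set.disjoint_left.2 fun f' h' h => hfa ?_⟩
      rw [← show f'.eval a = f.eval a from h]
      exact h' a (iterate_mem_sigmaSpan (Set.mem_singleton a) 0)
  have hVstable : Set.MapsTo (Points.conj hτ s₀ hs₀ hA₀) (V F) (V F) := fun f hf q hq =>
    τ.injective (by
      rw [Points.eval_conj, map_zero]
      exact hf _ (sigmaSpan_le_comap s₀ F hq))
  have hVrange : V F ⊆ Set.range (Points.comap π) :=
    hUV _ (Set.disjoint_compl_right_iff_subset.1 hFU) hVstable
  -- An element of the kernel vanishes at all points of the locally étale quotient by `F`.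
  refine ⟨F, hF, le_antisymm (fun a ha => ?_) (sigmaSpan_le_ker hπ hFker)⟩
  rw [← Ideal.Quotient.eq_zero_iff_mem]
  refine (hA₀.of_surjective (Ideal.Quotient.mkₐ k (sigmaSpan s₀ F))
    Ideal.Quotient.mk_surjective).eq_of_eval_eq (K := K) fun f => ?_
  obtain ⟨f', hf'⟩ := hVrange (show f.comap (Ideal.Quotient.mkₐ k (sigmaSpan s₀ F)) ∈ V F from
    fun q hq => by
      rw [Points.eval_comap, Ideal.Quotient.mkₐ_eq_mk, Ideal.Quotient.eq_zero_iff_mem.2 hq]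
      exact map_zero f.toAlgHom)
  have h1 := congrArg (fun g => Points.eval g a) hf'
  refine h1.symm.trans (Eq.trans ?_ (map_zero f.toAlgHom).symm)
  change f'.eval (π a) = 0
  rw [show π a = 0 from ha]
  exact map_zero f'.toAlgHom

/-- An algebra whose points form a subshift of finite type is finitely `σ`-presented: besides the
separable equations of finitely many generators, which make the presented algebra locally étale,
finitely many relations suffice. -/
theorem exists_presentation_of_isSubshiftOfFiniteType
    (hX : IsSubshiftOfFiniteType (Points.conj hτ s hs hA)) :
    ∃ (n : ℕ) (π : DiffPoly k n →ₐ[k] A),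
      Function.Surjective π ∧ (∀ p, π (DiffPoly.sigma σ n p) = s (π p)) ∧
      ∃ B : Set (DiffPoly k n), B.Finite ∧
        RingHom.ker π = sigmaSpan (DiffPoly.sigma σ n) B := by
  have := Points.compactSpace (K := K) hA
  have hsub : IsSubshift (Points.conj hτ s hs hA) := by
    obtain ⟨V, E, _, _, _, _, src, tgt, e, he⟩ := hX
    obtain ⟨hlc, hit⟩ := IsIsoToShiftSubset.exists_coding he
    refine isSubshift_of_coding (Points.continuous_conj hτ s hs hA) hlc fun f f' h => ?_
    refine e.injective (Subtype.ext (funext fun i => ?_))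
    rw [← hit f i, ← hit f' i, h]
  obtain ⟨B, hBfin, hB⟩ := (finite_generators_iff_isSubshift hτ s hs hA).2 hsub
  obtain ⟨n, a, -, rfl⟩ := hBfin.fin_param
  choose p hps hp using fun i => hA (a i)
  let S := DiffPoly.sigma σ n
  let π : DiffPoly k n →ₐ[k] A := MvPolynomial.aeval fun p : Fin n × ℕ => s^[p.2] (a p.1)
  have hπX (i : Fin n) (l : ℕ) : π (MvPolynomial.X (i, l)) = s^[l] (a i) :=
    MvPolynomial.aeval_X _ _
  have hsurj : Function.Surjective π := by
    rw [← AlgHom.range_eq_top, eq_top_iff, ← hB]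
    refine Algebra.adjoin_le ?_
    rintro _ ⟨_, ⟨i, rfl⟩, j, rfl⟩
    exact ⟨MvPolynomial.X (i, j), hπX i j⟩
  have hπ (q : DiffPoly k n) : π (S q) = s (π q) := by
    induction q using MvPolynomial.induction_on with
    | C c =>
      rw [DiffPoly.sigma_C]
      exact ((π.commutes (σ c)).trans (hs c).symm).trans (congrArg s (π.commutes c).symm)
    | add p q hp hq => simp only [map_add, hp, hq]
    | mul_X p x hp =>
      have hX : S (MvPolynomial.X x) = MvPolynomial.X (x.1, x.2 + 1) :=
        MvPolynomial.eval₂Hom_X' _ _ _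
      rw [map_mul, map_mul, hp, hX, hπX, map_mul, map_mul, Function.iterate_succ_apply', ← hπX]
  let r (i : Fin n) : DiffPoly k n := Polynomial.aeval (MvPolynomial.X (i, 0)) (p i)
  have hπr (i : Fin n) : π (r i) = 0 := by
    rw [← Polynomial.aeval_algHom_apply, hπX]
    exact hp i
  let I := sigmaSpan S (Set.range r)
  have hI : I ≤ RingHom.ker π := sigmaSpan_le_ker (s' := s) (π := (π : DiffPoly k n →+* A)) hπ
    (by rintro _ ⟨i, rfl⟩; exact hπr i)
  let mk : DiffPoly k n →ₐ[k] DiffPoly k n ⧸ I := Ideal.Quotient.mkₐ k I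
  have hmk : Function.Surjective mk := Ideal.Quotient.mk_surjective
  let s₀ : DiffPoly k n ⧸ I →+* DiffPoly k n ⧸ I :=
    Ideal.quotientMap I S (sigmaSpan_le_comap S (Set.range r))
  have hs₀mk (q : DiffPoly k n) : mk (S q) = s₀ (mk q) := rfl
  have hs₀i (j : ℕ) (q : DiffPoly k n) : mk (S^[j] q) = s₀^[j] (mk q) :=
    Function.Semiconj.iterate_right hs₀mk j q
  have hs₀ (c : k) : s₀ (algebraMap k _ c) = algebraMap k _ (σ c) :=
    (hs₀mk (MvPolynomial.C c)).symm.trans (congrArg mk (DiffPoly.sigma_C c))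
  have hadj : Algebra.adjoin k (Set.range fun x : Fin n × ℕ => mk (MvPolynomial.X x)) = ⊤ := by
    have h1 := congrArg (Subalgebra.map mk) (MvPolynomial.adjoin_range_X (R := k)
      (σ := Fin n × ℕ))
    rw [AlgHom.map_adjoin, ← Set.range_comp, Algebra.map_top,
      (AlgHom.range_eq_top mk).2 hmk] at h1
    exact h1
  have hA₀ : IsLocallyEtale k (DiffPoly k n ⧸ I) := by
    refine isLocallyEtale_of_adjoin hadj ?_
    rintro _ ⟨⟨i, l⟩, rfl⟩
    obtain ⟨q, hq, h⟩ := DiffPoly.exists_separable_aeval_X (σ := σ) (hps i) i l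
    refine ⟨q, hq, ?_⟩
    rw [Polynomial.aeval_algHom_apply, h]
    exact Ideal.Quotient.eq_zero_iff_mem.2 (iterate_mem_sigmaSpan (Set.mem_range_self i) l)
  let π₀ : DiffPoly k n ⧸ I →ₐ[k] A := Ideal.Quotient.liftₐ I π hI
  obtain ⟨F, hF, hFker⟩ := exists_finite_ker_eq_sigmaSpan hτ s hs hA s₀ hs₀ hA₀ π₀
    (fun x => (hsurj x).elim fun q hq => ⟨mk q, hq⟩)
    (fun x => (hmk x).elim fun q hq => hq ▸ hπ q)
    (T := Set.range fun i => mk (MvPolynomial.X (i, 0))) (Set.finite_range _)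
    (by
      rw [eq_top_iff, ← hadj]
      refine Algebra.adjoin_mono ?_
      rintro _ ⟨⟨i, l⟩, rfl⟩
      refine ⟨_, ⟨i, rfl⟩, l, ?_⟩
      rw [← hs₀i, DiffPoly.iterate_sigma_X]) hX
  let F' := Function.surjInv hmk '' F
  have hF' : mk '' F' = F := by
    rw [← Set.image_comp, (Function.rightInverse_surjInv hmk).comp_eq_id, Set.image_id]
  refine ⟨n, π, hsurj, hπ, Set.range r ∪ F', (Set.finite_range r).union (hF.image _),
    le_antisymm (fun q hq => ?_) ?_⟩
  · have h1 : mk q ∈ (sigmaSpan S F').map (mk : DiffPoly k n →+* DiffPoly k n ⧸ I) := by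
      rw [map_sigmaSpan (s' := s₀) (π := (mk : DiffPoly k n →+* DiffPoly k n ⧸ I)) hs₀mk]
      change mk q ∈ sigmaSpan s₀ (mk '' F')
      rw [hF', ← hFker]
      exact hq
    obtain ⟨q', hq', h⟩ := (Ideal.mem_map_iff_of_surjective _ hmk).1 h1
    have h2 : q - q' ∈ I := Ideal.Quotient.eq.1 h.symm
    rw [← sub_add_cancel q q']
    exact add_mem (sigmaSpan_mono Set.subset_union_left h2)
      (sigmaSpan_mono Set.subset_union_right hq')
  · refine sigmaSpan_le_ker (s' := s) (π := (π : DiffPoly k n →+* A)) hπ ?_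
    rintro b (⟨i, rfl⟩ | hb)
    · exact hπr i
    · have h1 : mk b ∈ sigmaSpan s₀ F :=
        iterate_mem_sigmaSpan (s := s₀) (hF' ▸ ⟨b, hb, rfl⟩ : mk b ∈ F) 0
      rw [← hFker] at h1
      exact h1

end FinitelyPresented

end

end DifferenceGalois

open DifferenceGalois
theorem theorem5p1 {k K : Type u} [Field k] [Field K] [Algebra k K] [IsSepClosure k K]
    (σ : k →+* k) (τ : K →+* K) (hτ : ∀ c, τ (algebraMap k K c) = algebraMap k K (σ c)) :
    (pointsFunctor hτ).IsEquivalence ∧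
    (∀ {A B : DiffLocEtaleAlg σ} (φ : A ⟶ B),
      Function.Surjective φ.hom.toAlgHom ↔
        Function.Injective ((pointsFunctor hτ).map φ.op).toFun) ∧
    (∀ {A B : DiffLocEtaleAlg σ} (φ : A ⟶ B),
      Function.Injective φ.hom.toAlgHom ↔
        Function.Surjective ((pointsFunctor hτ).map φ.op).toFun) ∧
    (∀ A : DiffLocEtaleAlg σ,
      A.obj.FinSigmaGenerated ↔ IsSubshift ((pointsFunctor hτ).obj (.op A)).sigma) ∧
    (∀ A : DiffLocEtaleAlg σ,
      A.obj.FinSigmaPresented ↔ IsSubshiftOfFiniteType ((pointsFunctor hτ).obj (.op A)).sigma) := by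
  refine ⟨pointsFunctor_isEquivalence hτ,
    fun {A B} φ => surjective_iff_injective_comap B.property φ.hom.toAlgHom,
    fun {A B} φ => injective_iff_surjective_comap A.property B.property φ.hom.toAlgHom,
    fun A => finite_generators_iff_isSubshift hτ A.obj.sigma A.obj.sigma_algebraMap A.property,
    fun A => ⟨?_, exists_presentation_of_isSubshiftOfFiniteType hτ A.obj.sigma
      A.obj.sigma_algebraMap A.property⟩⟩
  rintro ⟨n, π, hsurj, hπ, B, hB, hker⟩
  exact isSubshiftOfFiniteType_of_presentation hτ A.obj.sigma A.obj.sigma_algebraMap A.property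
    π hsurj hπ hB hker
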